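/- Let $\mathbb{T}=\mathbb{R}/2\pi\mathbb{Z}$, $D=\partial/\partial x$ and $\hat g(k)=(2\pi)^{-1}\int_{\mathbb{T}}e^{-ikx}g(x)\,dx$. For $m\ge 0$ let $H^m$ be the space of real-valued mean-free functions $g\in L^2(\mathbb{T})$ with $\|g\|_{H^m}^2:=\sum_{k\in\mathbb{Z}\setminus\{0\}}|k|^{2m}|\hat g(k)|^2<\infty$, and let $P_N$ denote the projection $P_Ng=\sum_{|k|\le N}\hat g(k)e^{ikx}$ onto the Fourier modes $|k|\le N$. Consider the damped-driven Korteweg--de Vries equation $$\partial_t u+\tfrac12 D(u^2)+D^3u+\gamma u=f,\qquad u(0)=u_0,\qquad x\in\mathbb{T},\ t>0. \tag{1}$$ A function $u\in C([0,\infty);H^2)$ is a solution of (1) if $u(0)=u_0$ and (1) holds in the weak sense: for every smooth $2\pi$-periodic $\varphi:\mathbb{R}\to\mathbb{R}$ and every $t\ge0$, $$\int_{\mathbb{T}}u(t)\varphi\,dx=\int_{\mathbb{T}}u_0\varphi\,dx+\int_0^t\int_{\mathbb{T}}\Bigl(\tfrac12u(s)^2D\varphi+u(s)D^3\varphi-\gamma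 u(s)\varphi+f\varphi\Bigr)dx\,ds.$$ **Theorem.** Let $\gamma>0$ and $f\in H^2$. Then there exists an integer $N>0$, depending only on $\gamma$ and $f$, such that for any two solutions $u,\tilde u\in C([0,\infty);H^2)$ of (1), with this same $\gamma$ and $f$ and with initial data $u_0,\tilde u_0\in H^2$ respectively, $$\lim_{t\to\infty}\|P_N(u(t)-\tilde u(t))\|_{L^2}=0\quad\text{implies}\quad\lim_{t\to\infty}\|u(t)-\tilde u(t)\|_{H^1}=0.$$ -/

import Mathlib

open Filter Topology MeasureTheory
open scoped ContDiff

namespace DampedKdV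

noncomputable section

/-- The circle of length `2π`. -/
abbrev T : Type := AddCircle (2 * Real.pi)

instance factTwoPiPos : Fact (0 < 2 * Real.pi) := ⟨Real.two_pi_pos⟩

/-- Real-valued square integrable functions on the circle; the norm is
`(∫ |g(x)|² dx)^{1/2}` with respect to the measure `dx` of total mass `2π`. -/
abbrev L2 : Type := Lp ℝ 2 (volume : Measure T)

/-- The Fourier coefficient `ĝ(k) = (2π)⁻¹ ∫ e^{-ikx} g(x) dx`. -/
def coeff (g : L2) (k : ℤ) : ℂ := fourierCoeff (fun x : T => ((g x : ℝ) : ℂ)) k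

/-- Membership in the Sobolev space `H^m` of mean-free periodic functions. -/
structure MemH (m : ℕ) (g : L2) : Prop where
  mean_free : ∫ x : T, g x = 0
  summable : Summable fun k : ℤ => (|k| : ℝ) ^ (2 * m) * ‖coeff g k‖ ^ 2

/-- The homogeneous Sobolev norm `(∑ |k|^{2m} |ĝ(k)|²)^{1/2}` of an element of `H^m`
(the term `k = 0` vanishes because the elements of `H^m` are mean-free). -/
def normH (m : ℕ) (g : L2) : ℝ :=
  Real.sqrt (∑' k : ℤ, (|k| : ℝ) ^ (2 * m) * ‖coeff g k‖ ^ 2)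

/-- The function `x ↦ ∑_{|k| ≤ N} ĝ(k) e^{ikx}`. The sum is real because `g` is real-valued
(the terms `k` and `-k` are complex conjugates), so that taking the real part only
changes the codomain. -/
def truncation (N : ℕ) (g : L2) : C(T, ℝ) where
  toFun x := (∑ k ∈ Finset.Icc (-(N : ℤ)) N, coeff g k * fourier k x).re
  continuous_toFun := by fun_prop

/-- The projection `P_N` of `L²` onto the Fourier modes `|k| ≤ N`. -/
def proj (N : ℕ) (g : L2) : L2 := ContinuousMap.toLp 2 volume ℝ (truncation N g)

/-- `u ∈ C([0,∞); H^m)`; the values of `u` at negative times are irrelevant. -/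
structure ContinuousInH (m : ℕ) (u : ℝ → L2) : Prop where
  memH : ∀ t, 0 ≤ t → MemH m (u t)
  tendsto : ∀ s, 0 ≤ s → Tendsto (fun t => normH m (u t - u s)) (𝓝[Set.Ici 0] s) (𝓝 0)

/-- The weak form of `-(1/2) D(v²) - D³v - γ v + f`, tested against a smooth periodic `φ`:
`∫ ((1/2) v² Dφ + v D³φ - γ v φ + f φ) dx`. -/
def weakRHS (γ : ℝ) (f v : L2) (φ : ℝ → ℝ) : ℝ :=
  ∫ x in (0 : ℝ)..(2 * Real.pi),
    ((1 / 2) * (v (x : T)) ^ 2 * deriv φ x + v (x : T) * iteratedDeriv 3 φ x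
      - γ * v (x : T) * φ x + f (x : T) * φ x)

/-- `u ∈ C([0,∞); H²)` is a solution of
`∂ₜu + (1/2) D(u²) + D³u + γ u = f`, `u(0) = u₀`, on the circle,
in the weak sense against smooth periodic test functions. -/
structure IsSolution (γ : ℝ) (f u₀ : L2) (u : ℝ → L2) : Prop where
  continuous : ContinuousInH 2 u
  initial : u 0 = u₀
  weak : ∀ φ : ℝ → ℝ, ContDiff ℝ ∞ φ → Function.Periodic φ (2 * Real.pi) → ∀ t, 0 ≤ t →
    ∫ x in (0 : ℝ)..(2 * Real.pi), u t (x : T) * φ x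
      = (∫ x in (0 : ℝ)..(2 * Real.pi), u₀ (x : T) * φ x)
        + ∫ s in (0 : ℝ)..t, weakRHS γ f (u s) φ

end

end DampedKdV

namespace DampedKdV

/-! ### Uniformly bounded finite sums -/

/-! In Fourier variables a solution satisfies `a' = i k³ a + r`, where `r = -γ a + f - (i/2) k (a *
a)`. The linear damping has no smoothing, so high modes are not damped faster than low ones.
Determining modes must therefore come from dispersion, through a normal form.

Let `w` be the difference and `W` the mean of two solutions, so that `w_t + D(W w) + D³w + γ w = 0`.
The rate of `‖w‖²` in `H¹` contains a trilinear term with symbol `k₁³ + k₂³` on `(w, w, W)`, which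
smallness of `w` in `L²` does not make small. On `k₁ + k₂ + k₃ = 0` one has `k₁³ + k₂³ + k₃³ = 3 k₁
k₂ k₃`. Adding to the energy the trilinear form with symbol `-(k₁³ + k₂³) / (3 k₁ k₂ k₃) = -1 + k₃²
/ (3 k₁ k₂)`, which is `diffSym`, cancels that term under the Airy flow
(`Orbit.hasRate_difference`). The correction and all remaining terms other than the damping are at
most `C ‖w‖_{L²} ‖w‖_{H¹}` (`PairBound.triLE_energy`, `PairBound.rate_le`).

Here `C` depends only on `γ`, `f` and an eventual `H¹` bound common to all solutions
(`exists_absorbing_ball`), obtained from the `L²` balance and then from the Hamiltonian `∫ (u_x² -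
u³/3)`. If the modes `|k| ≤ N` of `w` tend to zero, then `‖w‖_{L²} ≤ o(1) + ‖w‖_{H¹} / N`. For `N`
large the remainder is absorbed by the damping and the correction by half of the energy, up to
`o(1)`, and Grönwall's inequality concludes (`exists_determining_modes`).

The `H²` norm enters only qualitatively, locally in time, to make the sums converge and to
differentiate them term by term. -/

/-- All finite partial sums of `φ` are at most `B`. -/
def SumLE {ι : Type*} (φ : ι → ℝ) (B : ℝ) : Prop := ∀ s : Finset ι, ∑ i ∈ s, φ i ≤ B

namespace SumLE

variable {ι κ : Type*} {φ ψ : ι → ℝ} {A B : ℝ}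

theorem nonneg (h : SumLE φ B) : 0 ≤ B := by simpa using h ∅

theorem mono (h : SumLE ψ B) (hle : ∀ i, φ i ≤ ψ i) : SumLE φ B := fun s =>
  (Finset.sum_le_sum fun i _ => hle i).trans (h s)

theorem le_of_le (h : SumLE φ A) (hle : A ≤ B) : SumLE φ B := fun s => (h s).trans hle

theorem add (h : SumLE φ A) (h' : SumLE ψ B) : SumLE (fun i => φ i + ψ i) (A + B) := fun s => by
  rw [Finset.sum_add_distrib]
  exact add_le_add (h s) (h' s)

theorem const_mul (h : SumLE φ A) {c : ℝ} (hc : 0 ≤ c) : SumLE (fun i => c * φ i) (c * A) :=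
  fun s => by
    rw [← Finset.mul_sum]
    exact mul_le_mul_of_nonneg_left (h s) hc

theorem comp (h : SumLE φ B) (e : κ → ι) (he : Function.Injective e) :
    SumLE (fun i => φ (e i)) B := fun s => by
  have := h (s.map ⟨e, he⟩)
  simpa using this

theorem summable (h : SumLE φ B) (h0 : ∀ i, 0 ≤ φ i) : Summable φ :=
  summable_of_sum_le (fun i => h0 i) h

theorem tsum_le (h : SumLE φ B) (h0 : ∀ i, 0 ≤ φ i) : ∑' i, φ i ≤ B :=
  Real.tsum_le_of_sum_le (fun i => h0 i) h

theorem summable_of_norm {E : Type*} [NormedAddCommGroup E] [CompleteSpace E] {c : ι → E}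
    (h : SumLE (fun i => ‖c i‖) B) : Summable c :=
  (h.summable fun _ => norm_nonneg _).of_norm

theorem norm_tsum_le {E : Type*} [NormedAddCommGroup E] {c : ι → E}
    (h : SumLE (fun i => ‖c i‖) B) : ‖∑' i, c i‖ ≤ B :=
  (norm_tsum_le_tsum_norm (h.summable fun _ => norm_nonneg _)).trans
    (h.tsum_le fun _ => norm_nonneg _)

theorem le_apply (h : SumLE φ B) (i : ι) : φ i ≤ B := by simpa using h {i}

end SumLE

theorem _root_.Summable.sumLE {ι : Type*} {φ : ι → ℝ} (h : Summable φ) (h0 : ∀ i, 0 ≤ φ i) :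
    SumLE φ (∑' i, φ i) := fun s => h.sum_le_tsum s fun i _ => h0 i

/-! ### Square-summable sequences and Cauchy–Schwarz -/

/-- The `ℓ²` norm of `x` is at most `A`. -/
def L2Le {ι : Type*} (x : ι → ℝ) (A : ℝ) : Prop := 0 ≤ A ∧ SumLE (fun i => x i ^ 2) (A ^ 2)

namespace L2Le

variable {ι κ : Type*} {x y : ι → ℝ} {A B : ℝ}

theorem mono (h : L2Le y A) (h0 : ∀ i, 0 ≤ x i) (hle : ∀ i, x i ≤ y i) : L2Le x A :=
  ⟨h.1, h.2.mono fun i => pow_le_pow_left₀ (h0 i) (hle i) 2⟩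

theorem le_of_le (h : L2Le x A) (hle : A ≤ B) : L2Le x B :=
  ⟨h.1.trans hle, h.2.le_of_le (pow_le_pow_left₀ h.1 hle 2)⟩

theorem sum_mul_le (hx : L2Le x A) (hy : L2Le y B) : SumLE (fun i => x i * y i) (A * B) := by
  intro s
  have h1 := Finset.sum_mul_sq_le_sq_mul_sq s x y
  have h2 : (∑ i ∈ s, x i ^ 2) * ∑ i ∈ s, y i ^ 2 ≤ (A * B) ^ 2 := by
    rw [mul_pow]
    exact mul_le_mul (hx.2 s) (hy.2 s) (Finset.sum_nonneg fun i _ => sq_nonneg _) (sq_nonneg _)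
  exact (le_abs_self _).trans (abs_le_of_sq_le_sq (h1.trans h2) (mul_nonneg hx.1 hy.1))

theorem add (hx : L2Le x A) (hy : L2Le y B) : L2Le (fun i => x i + y i) (A + B) := by
  refine ⟨add_nonneg hx.1 hy.1, fun s => ?_⟩
  have h1 := hx.2 s
  have h2 := hy.2 s
  have h3 := (hx.sum_mul_le hy) s
  have : ∑ i ∈ s, (x i + y i) ^ 2
      = ∑ i ∈ s, x i ^ 2 + 2 * ∑ i ∈ s, x i * y i + ∑ i ∈ s, y i ^ 2 := by
    rw [Finset.mul_sum, ← Finset.sum_add_distrib, ← Finset.sum_add_distrib]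
    exact Finset.sum_congr rfl fun i _ => by ring
  rw [this]
  nlinarith

theorem const_mul (hx : L2Le x A) {c : ℝ} (hc : 0 ≤ c) : L2Le (fun i => c * x i) (c * A) :=
  ⟨mul_nonneg hc hx.1, by
    have := hx.2.const_mul (sq_nonneg c)
    simpa only [mul_pow] using this⟩

theorem comp (h : L2Le x A) (e : κ → ι) (he : Function.Injective e) :
    L2Le (fun i => x (e i)) A := ⟨h.1, h.2.comp e he⟩

theorem le_apply (h : L2Le x A) (i : ι) : x i ≤ A :=
  (le_abs_self _).trans (abs_le_of_sq_le_sq (h.2.le_apply i) h.1)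

theorem of_summable (h : Summable fun i => x i ^ 2) : L2Le x (Real.sqrt (∑' i, x i ^ 2)) :=
  ⟨Real.sqrt_nonneg _, by
    rw [Real.sq_sqrt (tsum_nonneg fun _ => sq_nonneg _)]
    exact h.sumLE fun _ => sq_nonneg _⟩

theorem summable (h : L2Le x A) : Summable fun i => x i ^ 2 := h.2.summable fun _ => sq_nonneg _

theorem sqrt_tsum_le (h : L2Le x A) : Real.sqrt (∑' i, x i ^ 2) ≤ A :=
  Real.sqrt_le_iff.2 ⟨h.1, h.2.tsum_le fun _ => sq_nonneg _⟩

end L2Le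

/-! ### Sobolev embedding on the Fourier side -/

/-- The constant in `∑ |x k| ≤ c (∑ k² |x k|²)^{1/2}`. -/
noncomputable def embConst : ℝ := Real.sqrt (∑' k : ℤ, (1 / |(k : ℝ)|) ^ 2)

theorem embConst_nonneg : 0 ≤ embConst := Real.sqrt_nonneg _

theorem l2Le_inv_abs : L2Le (fun k : ℤ => 1 / |(k : ℝ)|) embConst := by
  refine L2Le.of_summable ?_
  have := (Real.summable_one_div_int_pow (p := 2)).2 (by norm_num)
  refine this.congr fun k => ?_
  rw [div_pow, sq_abs, one_pow]

/-- Cauchy–Schwarz against `1 / |k|`: this is the embedding of `H¹` into absolutely convergent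
Fourier series, and it replaces every sup-norm bound. The mode `k = 0` has to vanish because the
weight does not see it. -/
theorem L2Le.sumLE_of_weighted {x : ℤ → ℝ} {A : ℝ} (hx : L2Le (fun k : ℤ => |(k : ℝ)| * x k) A)
    (h0 : x 0 = 0) : SumLE x (embConst * A) := by
  refine (l2Le_inv_abs.sum_mul_le hx).mono fun k => le_of_eq ?_
  by_cases hk : k = 0
  · simp [hk, h0]
  · have : |(k : ℝ)| ≠ 0 := by simpa using hk
    field_simp

theorem one_le_abs_intCast {k : ℤ} (hk : k ≠ 0) : 1 ≤ |(k : ℝ)| := by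
  exact_mod_cast Int.one_le_abs hk

theorem L2Le.of_weighted {x : ℤ → ℝ} {A : ℝ} (hx : L2Le (fun k : ℤ => |(k : ℝ)| * x k) A)
    (hn : ∀ k, 0 ≤ x k) (h0 : x 0 = 0) : L2Le x A := by
  refine hx.mono hn fun k => ?_
  by_cases hk : k = 0
  · simp [hk, h0]
  · exact le_mul_of_one_le_left (hn k) (one_le_abs_intCast hk)

/-! ### Trilinear sums over `k₁ + k₂ + k₃ = 0` -/

/-- For a fixed second frequency, Cauchy–Schwarz in the first one pairs the two `ℓ²` factors; the
`ℓ¹` factor then sums the result. This is the Fourier form of `L² · L^∞ · L²`. -/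
theorem sumLE_tri {x y z : ℤ → ℝ} {A B C : ℝ} (hx : L2Le x A) (hy : SumLE y B)
    (hz : L2Le z C) (x0 : ∀ k, 0 ≤ x k) (y0 : ∀ k, 0 ≤ y k) (z0 : ∀ k, 0 ≤ z k) :
    SumLE (fun p : ℤ × ℤ => x p.1 * y p.2 * z (-p.1 - p.2)) (A * B * C) := by
  classical
  intro s
  have hsub : s ⊆ (s.image Prod.fst) ×ˢ (s.image Prod.snd) := by
    intro p hp
    simp only [Finset.mem_product, Finset.mem_image]
    exact ⟨⟨p, hp, rfl⟩, ⟨p, hp, rfl⟩⟩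
  refine (Finset.sum_le_sum_of_subset_of_nonneg hsub fun p _ _ =>
    mul_nonneg (mul_nonneg (x0 _) (y0 _)) (z0 _)).trans ?_
  rw [Finset.sum_product_right]
  have key : ∀ j : ℤ, ∑ i ∈ s.image Prod.fst, x i * y j * z (-i - j) ≤ A * C * y j := by
    intro j
    have h1 := (hx.sum_mul_le (hz.comp (fun i => -i - j)
      (fun a b h => by simpa using h))) (s.image Prod.fst)
    calc _ = y j * ∑ i ∈ s.image Prod.fst, x i * z (-i - j) := by
          rw [Finset.mul_sum]
          exact Finset.sum_congr rfl fun i _ => by ring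
      _ ≤ y j * (A * C) := mul_le_mul_of_nonneg_left h1 (y0 j)
      _ = _ := by ring
  refine (Finset.sum_le_sum fun j _ => key j).trans ?_
  rw [← Finset.mul_sum]
  calc _ ≤ A * C * B := mul_le_mul_of_nonneg_left (hy _) (mul_nonneg hx.1 hz.1)
    _ = _ := by ring

theorem swap_injective : Function.Injective fun p : ℤ × ℤ => (p.2, p.1) :=
  fun _ _ h => by simp only [Prod.mk.injEq] at h; exact Prod.ext h.2 h.1

/-- The cyclic permutation of the frequencies of a resonant triple. -/
def rot : ℤ × ℤ ≃ ℤ × ℤ where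
  toFun p := (p.2, -p.1 - p.2)
  invFun p := (-p.1 - p.2, p.1)
  left_inv p := by
    ext
    · show -p.2 - (-p.1 - p.2) = p.1
      ring
    · rfl
  right_inv p := by
    ext
    · rfl
    · show -(-p.1 - p.2) - p.1 = p.2
      ring

@[simp] theorem rot_fst (p : ℤ × ℤ) : (rot p).1 = p.2 := rfl
@[simp] theorem rot_snd (p : ℤ × ℤ) : (rot p).2 = -p.1 - p.2 := rfl
@[simp] theorem third_rot (p : ℤ × ℤ) : -p.2 - (-p.1 - p.2) = p.1 := by ring

theorem SumLE.rot {φ : ℤ × ℤ → ℝ} {B : ℝ} (h : SumLE φ B) :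
    SumLE (fun p : ℤ × ℤ => φ (p.2, -p.1 - p.2)) B := h.comp _ DampedKdV.rot.injective

theorem SumLE.swap {φ : ℤ × ℤ → ℝ} {B : ℝ} (h : SumLE φ B) :
    SumLE (fun p : ℤ × ℤ => φ (p.2, p.1)) B := h.comp _ swap_injective

/-- Trilinear bound with the summable factor in the third position. -/
theorem sumLE_tri₃ {x y z : ℤ → ℝ} {A B C : ℝ} (hx : L2Le x A) (hy : L2Le y B)
    (hz : SumLE z C) (x0 : ∀ k, 0 ≤ x k) (y0 : ∀ k, 0 ≤ y k) (z0 : ∀ k, 0 ≤ z k) :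
    SumLE (fun p : ℤ × ℤ => x p.1 * y p.2 * z (-p.1 - p.2)) (A * B * C) := by
  have := (sumLE_tri hy hz hx y0 z0 x0).rot
  refine SumLE.le_of_le (this.mono fun p => le_of_eq ?_) (le_of_eq (by ring))
  simp only [third_rot]; ring

/-! ### Convolutions -/

/-- The convolution of two sequences on `ℤ`. -/
noncomputable def conv (a b : ℤ → ℂ) (k : ℤ) : ℂ := ∑' j : ℤ, a j * b (k - j)

theorem sub_injective_right (k : ℤ) : Function.Injective fun j : ℤ => k - j :=
  fun _ _ h => by simpa using h

theorem summable_conv {a b : ℤ → ℂ} {A B : ℝ} (ha : L2Le (fun k => ‖a k‖) A)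
    (hb : L2Le (fun k => ‖b k‖) B) (k : ℤ) : Summable fun j : ℤ => a j * b (k - j) := by
  have := ha.sum_mul_le (hb.comp (fun j => k - j) (sub_injective_right k))
  refine SumLE.summable_of_norm (B := A * B) ?_
  simpa only [norm_mul] using this

theorem summable_rconv {x y : ℤ → ℝ} {A B : ℝ} (hx : L2Le x A) (hy : SumLE y B)
    (x0 : ∀ k, 0 ≤ x k) (y0 : ∀ k, 0 ≤ y k) (k : ℤ) : Summable fun j : ℤ => x j * y (k - j) := by
  refine SumLE.summable (B := A * B) ?_ fun j => mul_nonneg (x0 _) (y0 _)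
  refine ((hy.comp (fun j => k - j) (sub_injective_right k)).const_mul hx.1).mono fun j => ?_
  exact mul_le_mul_of_nonneg_right (hx.le_apply j) (y0 _)

/-- Young's inequality `ℓ² * ℓ¹ ⊆ ℓ²`. -/
theorem l2Le_rconv {x y : ℤ → ℝ} {A B : ℝ} (hx : L2Le x A) (hy : SumLE y B)
    (x0 : ∀ k, 0 ≤ x k) (y0 : ∀ k, 0 ≤ y k) :
    L2Le (fun k : ℤ => ∑' j : ℤ, x j * y (k - j)) (A * B) := by
  have hB := hy.nonneg
  refine ⟨mul_nonneg hx.1 hB, fun s => ?_⟩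
  -- Truncating the inner sum reduces the estimate to finite sums with a bound independent of the
  -- truncation.
  have hlim : Tendsto (fun t : Finset ℤ => ∑ k ∈ s, (∑ j ∈ t, x j * y (k - j)) ^ 2) atTop
      (𝓝 (∑ k ∈ s, (∑' j : ℤ, x j * y (k - j)) ^ 2)) :=
    tendsto_finsetSum _ fun k _ => (summable_rconv hx hy x0 y0 k).hasSum.pow 2
  refine le_of_tendsto' hlim fun t => ?_
  have h1 : ∀ k ∈ s, (∑ j ∈ t, x j * y (k - j)) ^ 2 ≤ B * ∑ j ∈ t, x j ^ 2 * y (k - j) := by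
    intro k _
    refine (Finset.sum_sq_le_sum_mul_sum_of_sq_le_mul t (f := fun j => y (k - j))
      (g := fun j => x j ^ 2 * y (k - j)) (fun j _ => y0 _)
      (fun j _ => mul_nonneg (sq_nonneg _) (y0 _)) (fun j _ => le_of_eq (by ring))).trans ?_
    refine mul_le_mul_of_nonneg_right ((hy.comp (fun j => k - j) (sub_injective_right k)) t) ?_
    exact Finset.sum_nonneg fun j _ => mul_nonneg (sq_nonneg _) (y0 _)
  refine (Finset.sum_le_sum h1).trans ?_
  rw [← Finset.mul_sum, Finset.sum_comm]
  have h2 : ∀ j ∈ t, ∑ k ∈ s, x j ^ 2 * y (k - j) ≤ B * x j ^ 2 := by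
    intro j _
    rw [← Finset.mul_sum, mul_comm B]
    exact mul_le_mul_of_nonneg_left ((hy.comp (fun k => k - j) (fun a b h => by simpa using h)) s)
      (sq_nonneg _)
  calc B * ∑ j ∈ t, ∑ k ∈ s, x j ^ 2 * y (k - j) ≤ B * ∑ j ∈ t, B * x j ^ 2 :=
        mul_le_mul_of_nonneg_left (Finset.sum_le_sum h2) hB
    _ = B * B * ∑ j ∈ t, x j ^ 2 := by rw [← Finset.mul_sum]; ring
    _ ≤ B * B * A ^ 2 := mul_le_mul_of_nonneg_left (hx.2 t) (mul_nonneg hB hB)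
    _ = (A * B) ^ 2 := by ring

theorem norm_conv_le {a b : ℤ → ℂ} {A B : ℝ} (ha : L2Le (fun k => ‖a k‖) A)
    (hb : SumLE (fun k => ‖b k‖) B) (k : ℤ) :
    ‖conv a b k‖ ≤ ∑' j : ℤ, ‖a j‖ * ‖b (k - j)‖ := by
  have h := summable_rconv ha hb (fun _ => norm_nonneg _) (fun _ => norm_nonneg _) k
  refine tsum_of_norm_bounded h.hasSum fun j => ?_
  rw [norm_mul]

theorem l2Le_conv {a b : ℤ → ℂ} {A B : ℝ} (ha : L2Le (fun k => ‖a k‖) A)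
    (hb : SumLE (fun k => ‖b k‖) B) : L2Le (fun k => ‖conv a b k‖) (A * B) :=
  (l2Le_rconv ha hb (fun _ => norm_nonneg _) (fun _ => norm_nonneg _)).mono
    (fun _ => norm_nonneg _) (norm_conv_le ha hb)

theorem tsum_sub_left (f : ℤ → ℝ) (k : ℤ) : ∑' j : ℤ, f (k - j) = ∑' j, f j :=
  (Equiv.subLeft k).tsum_eq f

/-- The Leibniz rule in the form `|k| ≤ |j| + |k - j|`: the derivative falls on one factor, which
stays in `ℓ²`, while the other factor is in `ℓ¹`. -/
theorem l2Le_abs_mul_conv {a b : ℤ → ℂ} {A A' B B' : ℝ} (ha : L2Le (fun k => ‖a k‖) A)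
    (hb : SumLE (fun k => ‖b k‖) B) (ha1 : SumLE (fun k => ‖a k‖) A')
    (hda : L2Le (fun k : ℤ => |(k : ℝ)| * ‖a k‖) B')
    {B'' : ℝ} (hdb : L2Le (fun k : ℤ => |(k : ℝ)| * ‖b k‖) B'') :
    L2Le (fun k : ℤ => |(k : ℝ)| * ‖conv a b k‖) (B' * B + B'' * A') := by
  have n0 : ∀ (c : ℤ → ℂ) (k : ℤ), 0 ≤ |(k : ℝ)| * ‖c k‖ := fun c k => by positivity
  have h1 := l2Le_rconv hda hb (n0 a) (fun _ => norm_nonneg _)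
  have h2 := l2Le_rconv hdb ha1 (n0 b) (fun _ => norm_nonneg _)
  refine (h1.add h2).mono (fun k => by positivity) fun k => ?_
  have s1 := summable_rconv hda hb (n0 a) (fun _ => norm_nonneg _) k
  have s2 := summable_rconv hdb ha1 (n0 b) (fun _ => norm_nonneg _) k
  have s2' : Summable fun j : ℤ => |((k - j : ℤ) : ℝ)| * ‖b (k - j)‖ * ‖a (k - (k - j))‖ :=
    (Equiv.subLeft k).summable_iff.2 s2
  have s0 := summable_rconv ha hb (fun _ => norm_nonneg _) (fun _ => norm_nonneg _) k
  rw [← tsum_sub_left (fun j : ℤ => |(j : ℝ)| * ‖b j‖ * ‖a (k - j)‖) k, ← Summable.tsum_add s1 s2']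
  refine (mul_le_mul_of_nonneg_left (norm_conv_le ha hb k) (abs_nonneg _)).trans ?_
  rw [← tsum_mul_left]
  refine Summable.tsum_le_tsum (fun j => ?_) (s0.mul_left _) (s1.add s2')
  rw [sub_sub_cancel]
  have : |(k : ℝ)| ≤ |(j : ℝ)| + |((k - j : ℤ) : ℝ)| := by
    rw [show (k : ℝ) = (j : ℝ) + ((k - j : ℤ) : ℝ) by push_cast; ring]
    refine (abs_add_le _ _).trans (le_of_eq ?_)
    push_cast; ring_nf
  have h3 : 0 ≤ ‖a j‖ * ‖b (k - j)‖ := by positivity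
  calc _ ≤ (|(j : ℝ)| + |((k - j : ℤ) : ℝ)|) * (‖a j‖ * ‖b (k - j)‖) :=
        mul_le_mul_of_nonneg_right this h3
    _ = _ := by ring

/-- Pairing of a convolution with a third sequence, as a sum over resonant triples. -/
theorem tsum_tri_eq {a b c : ℤ → ℂ}
    (h : Summable fun p : ℤ × ℤ => a p.1 * b p.2 * c (-p.1 - p.2)) :
    ∑' p : ℤ × ℤ, a p.1 * b p.2 * c (-p.1 - p.2) = ∑' k : ℤ, c k * conv a b (-k) := by
  have h' : Summable fun p : ℤ × ℤ => c p.1 * (a p.2 * b (-p.1 - p.2)) := by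
    refine (rot.summable_iff.2 h).congr fun p => ?_
    simp only [Function.comp_apply, rot_fst, rot_snd, third_rot]; ring
  rw [← rot.tsum_eq]
  calc _ = ∑' p : ℤ × ℤ, c p.1 * (a p.2 * b (-p.1 - p.2)) := by
        refine tsum_congr fun p => ?_
        simp only [rot_fst, rot_snd, third_rot]; ring
    _ = _ := by
        rw [h'.tsum_prod]
        exact tsum_congr fun k => by
          rw [show c k * conv a b (-k) = ∑' j : ℤ, c k * (a j * b (-k - j)) from tsum_mul_left.symm]

/-! ### Absolutely continuous evolution of functionals -/

/-- `F` is an antiderivative of the locally integrable function `D` on `(0, ∞)`. -/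
def HasRate {E : Type*} [NormedAddCommGroup E] [NormedSpace ℝ E] (F D : ℝ → E) : Prop :=
  ∀ s t, 0 < s → s ≤ t → IntervalIntegrable D volume s t ∧ F t - F s = ∫ τ in s..t, D τ

namespace HasRate

variable {E : Type*} [NormedAddCommGroup E] [NormedSpace ℝ E] {F G D D' : ℝ → E}

theorem add (hF : HasRate F D) (hG : HasRate G D') :
    HasRate (fun t => F t + G t) (fun t => D t + D' t) := fun s t hs hst => by
  obtain ⟨h1, h2⟩ := hF s t hs hst
  obtain ⟨h3, h4⟩ := hG s t hs hst
  refine ⟨h1.add h3, ?_⟩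
  rw [intervalIntegral.integral_add h1 h3, ← h2, ← h4, add_sub_add_comm]

theorem re {F D : ℝ → ℂ} (hF : HasRate F D) :
    HasRate (fun t => (F t).re) (fun t => (D t).re) := fun s t hs hst => by
  obtain ⟨h1, h2⟩ := hF s t hs hst
  refine ⟨⟨h1.1.re, h1.2.re⟩, ?_⟩
  rw [← Complex.sub_re, h2, intervalIntegral.integral_of_le hst,
    intervalIntegral.integral_of_le hst]
  exact (integral_re h1.1).symm

theorem congr (hF : HasRate F D) (h : ∀ t, 0 < t → D t = D' t) : HasRate F D' :=
  fun s t hs hst => by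
  obtain ⟨h1, h2⟩ := hF s t hs hst
  have h3 : ∀ τ ∈ Set.uIoc s t, D τ = D' τ := fun τ hτ => by
    rw [Set.uIoc_of_le hst] at hτ
    exact h τ (hs.trans hτ.1)
  refine ⟨h1.congr h3, h2.trans ?_⟩
  exact intervalIntegral.integral_congr_ae (Eventually.of_forall h3)

theorem continuousOn {F D : ℝ → ℝ} (hF : HasRate F D) {a b : ℝ} (ha : 0 < a) :
    ContinuousOn F (Set.Icc a b) := by
  rcases lt_or_ge b a with hab | hab
  · simp [Set.Icc_eq_empty_of_lt hab]
  have h := intervalIntegral.continuousOn_primitive_interval' (hF a b ha hab).1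
    (Set.left_mem_uIcc)
  rw [Set.uIcc_of_le hab] at h
  refine (h.add (continuousOn_const (c := F a))).congr fun t ht => ?_
  simp [← (hF a t ha ht.1).2]

/-- Grönwall's inequality for absolutely continuous functions. -/
theorem eventually_le {F D : ℝ → ℝ} (hF : HasRate F D) {c C t₀ : ℝ} (hc : 0 < c) (ht₀ : 0 < t₀)
    (h : ∀ t, t₀ ≤ t → D t ≤ -c * F t + C) {ε : ℝ} (hε : 0 < ε) :
    ∀ᶠ t in atTop, F t ≤ C / c + ε := by
  have key : ∀ t, t₀ ≤ t → F t ≤ gronwallBound (F t₀) (-c) C (t - t₀) := by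
    intro t ht
    refine le_gronwallBound_of_liminf_deriv_right_le (f' := fun x => -c * F x + C)
      (hF.continuousOn ht₀ (b := t)) ?_ le_rfl (fun x _ => le_rfl) t ⟨ht, le_rfl⟩
    intro x hx r hr
    obtain ⟨r', hr1, hr2⟩ := exists_between hr
    have hcont : ContinuousWithinAt (fun x => -c * F x + C) (Set.Ici x) x := by
      have : ContinuousWithinAt F (Set.Icc x t) x :=
        (hF.continuousOn (ht₀.trans_le hx.1)) x ⟨le_rfl, hx.2.le⟩
      have h2 : ContinuousWithinAt F (Set.Ici x) x :=
        this.mono_of_mem_nhdsWithin (Icc_mem_nhdsGE hx.2)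
      exact (h2.const_smul (-c)).add continuousWithinAt_const
    have hev := hcont.eventually (gt_mem_nhds hr1)
    obtain ⟨y, hy, hsub⟩ := (mem_nhdsGE_iff_exists_Ico_subset).1 hev
    -- `F` need not be differentiable. Since `F` is continuous, its rate stays below `r'` just to
    -- the right of `x`, and integrating this bounds the difference quotient.
    have : ∀ᶠ z in 𝓝[>] x, (z - x)⁻¹ * (F z - F x) < r := by
      filter_upwards [Ioo_mem_nhdsGT hy] with z hz
      have hpos : 0 < z - x := sub_pos.2 hz.1
      obtain ⟨i1, i2⟩ := hF x z (ht₀.trans_le hx.1) hz.1.le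
      have : ∫ τ in x..z, D τ ≤ ∫ _ in x..z, r' := by
        refine intervalIntegral.integral_mono_on hz.1.le i1 intervalIntegrable_const ?_
        intro τ hτ
        have h1 : -c * F τ + C < r' := hsub ⟨hτ.1, hτ.2.trans_lt hz.2⟩
        exact (h τ (hx.1.trans hτ.1)).trans h1.le
      rw [intervalIntegral.integral_const, smul_eq_mul, ← i2] at this
      calc (z - x)⁻¹ * (F z - F x) ≤ (z - x)⁻¹ * ((z - x) * r') := by gcongr
        _ = r' := by field_simp
        _ < r := hr2
    exact this.frequently
  have hlim : Tendsto (fun t => gronwallBound (F t₀) (-c) C (t - t₀)) atTop (𝓝 (C / c)) := by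
    rw [gronwallBound_of_K_ne_0 (neg_ne_zero.2 hc.ne')]
    have he : Tendsto (fun t => Real.exp (-c * (t - t₀))) atTop (𝓝 0) := by
      refine Real.tendsto_exp_atBot.comp ?_
      refine Tendsto.const_mul_atTop_of_neg (neg_lt_zero.2 hc) ?_
      exact tendsto_atTop_add_const_right _ _ tendsto_id
    have := (he.const_mul (F t₀)).add ((he.sub_const 1).const_mul (C / -c))
    refine this.trans_eq ?_
    congr 1
    field_simp
    ring
  filter_upwards [hlim.eventually (gt_mem_nhds (lt_add_of_pos_right _ hε)), eventually_ge_atTop t₀]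
    with t h1 h2
  exact (key t h2).trans h1.le

end HasRate

/-- The summed derivatives are only known to be bounded on bounded time intervals, so no classical
derivative of the sum is claimed. The bound on partial sums of norms justifies exchanging sum and
integral, which is all that Grönwall's inequality needs. -/
theorem hasRate_tsum {ι E : Type*} [Countable ι] [NormedAddCommGroup E] [NormedSpace ℝ E]
    [CompleteSpace E] {X Y : ι → ℝ → E} (hd : ∀ i t, 0 < t → HasDerivAt (X i) (Y i t) t)
    (hc : ∀ i, ContinuousOn (Y i) (Set.Ioi 0))
    (hX : ∀ t, 0 < t → Summable fun i => X i t)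
    (hY : ∀ T, ∃ B, ∀ t, 0 < t → t ≤ T → SumLE (fun i => ‖Y i t‖) B) :
    HasRate (fun t => ∑' i, X i t) (fun t => ∑' i, Y i t) := by
  intro s t hs hst
  obtain ⟨B, hB⟩ := hY t
  have hsub : Set.uIcc s t ⊆ Set.Ioi 0 := by
    rw [Set.uIcc_of_le hst]; exact fun x hx => hs.trans_le hx.1
  have hint : ∀ i, IntervalIntegrable (Y i) volume s t := fun i =>
    ((hc i).mono hsub).intervalIntegrable
  have hsl : ∀ τ ∈ Set.Ioc s t, SumLE (fun i => ‖Y i τ‖) B := fun τ hτ =>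
    hB τ (hs.trans hτ.1) hτ.2
  have hmeas : AEStronglyMeasurable (fun τ => ∑' i, Y i τ) (volume.restrict (Set.Ioc s t)) := by
    refine aestronglyMeasurable_of_tendsto_ae (atTop : Filter (Finset ι))
      (f := fun (u : Finset ι) τ => ∑ i ∈ u, Y i τ) (fun u => ?_) ?_
    · exact Finset.aestronglyMeasurable_fun_sum u fun i _ => (hint i).1.1
    · refine (ae_restrict_mem measurableSet_Ioc).mono fun τ hτ => ?_
      exact (hsl τ hτ).summable_of_norm.hasSum
  have hI : IntervalIntegrable (fun τ => ∑' i, Y i τ) volume s t := by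
    rw [intervalIntegrable_iff_integrableOn_Ioc_of_le hst]
    refine Integrable.of_bound hmeas B ?_
    exact (ae_restrict_mem measurableSet_Ioc).mono fun τ hτ => (hsl τ hτ).norm_tsum_le
  refine ⟨hI, ?_⟩
  have hsum : Summable fun i => ∫ τ in Set.Ioc s t, ‖Y i τ‖ := by
    refine SumLE.summable (B := B * (t - s)) (fun u => ?_) fun i =>
      integral_nonneg fun _ => norm_nonneg _
    rw [← integral_finsetSum u fun i _ => (hint i).1.norm]
    have : ∫ τ in Set.Ioc s t, ∑ i ∈ u, ‖Y i τ‖ ≤ ∫ _ in Set.Ioc s t, B := by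
      refine setIntegral_mono_on ?_ ?_ measurableSet_Ioc fun τ hτ => hsl τ hτ u
      · exact integrable_finsetSum u fun i _ => (hint i).1.norm
      · exact integrableOn_const (by simp)
    refine this.trans (le_of_eq ?_)
    rw [setIntegral_const, smul_eq_mul, mul_comm]
    simp [Measure.real, hst]
  have h1 := hasSum_integral_of_summable_integral_norm (fun i => (hint i).1) hsum
  have h2 : ∀ i, ∫ τ in Set.Ioc s t, Y i τ = X i t - X i s := fun i => by
    rw [← intervalIntegral.integral_of_le hst]
    exact intervalIntegral.integral_eq_sub_of_hasDerivAt
      (fun x hx => hd i x (hsub hx)) (hint i)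
  rw [intervalIntegral.integral_of_le hst, ← h1.tsum_eq,
    ← (hX t (hs.trans_le hst)).tsum_sub (hX s hs)]
  exact tsum_congr fun i => (h2 i).symm

open Complex (I)

/-! ### Trilinear functionals -/

/-- The trilinear functional with symbol `m`. -/
noncomputable def tri (m : ℤ × ℤ → ℂ) (a b c : ℤ → ℂ) : ℂ :=
  ∑' p : ℤ × ℤ, m p * (a p.1 * b p.2 * c (-p.1 - p.2))

/-- The trilinear sum with symbol `m` converges absolutely, with bound `B`. -/
def TriLE (m : ℤ × ℤ → ℂ) (a b c : ℤ → ℂ) (B : ℝ) : Prop :=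
  SumLE (fun p : ℤ × ℤ => ‖m p‖ * (‖a p.1‖ * ‖b p.2‖ * ‖c (-p.1 - p.2)‖)) B

namespace TriLE

variable {m m' : ℤ × ℤ → ℂ} {a b c : ℤ → ℂ} {B B' : ℝ}

theorem sumLE_norm (h : TriLE m a b c B) :
    SumLE (fun p : ℤ × ℤ => ‖m p * (a p.1 * b p.2 * c (-p.1 - p.2))‖) B :=
  SumLE.mono h fun p => le_of_eq (by simp only [norm_mul])

theorem summable (h : TriLE m a b c B) :
    Summable fun p : ℤ × ℤ => m p * (a p.1 * b p.2 * c (-p.1 - p.2)) :=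
  h.sumLE_norm.summable_of_norm

theorem norm_le (h : TriLE m a b c B) : ‖tri m a b c‖ ≤ B := h.sumLE_norm.norm_tsum_le

theorem tri_add (h : TriLE m a b c B) (h' : TriLE m' a b c B') :
    tri (fun p => m p + m' p) a b c = tri m a b c + tri m' a b c := by
  rw [tri, tri, tri, ← h.summable.tsum_add h'.summable]
  exact tsum_congr fun p => by ring

theorem add (h : TriLE m a b c B) (h' : TriLE m' a b c B') :
    TriLE (fun p => m p + m' p) a b c (B + B') :=
  (SumLE.add h h').mono fun p => by
    rw [← add_mul]
    exact mul_le_mul_of_nonneg_right (norm_add_le _ _) (by positivity)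

theorem const_mul (h : TriLE m a b c B) (z : ℂ) : TriLE (fun p => z * m p) a b c (‖z‖ * B) :=
  (SumLE.const_mul h (norm_nonneg z)).mono fun p => le_of_eq (by rw [norm_mul]; ring)

theorem swap (h : TriLE m a b c B) : TriLE (fun p => m (p.2, p.1)) b a c B := by
  refine (SumLE.swap h).mono fun p => le_of_eq ?_
  rw [show -p.2 - p.1 = -p.1 - p.2 by ring, mul_comm ‖b _‖]

theorem rot (h : TriLE m a b c B) : TriLE (fun p => m (p.2, -p.1 - p.2)) c a b B := by
  refine (SumLE.rot h).mono fun p => le_of_eq ?_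
  simp only [third_rot]; ring

end TriLE

theorem tri_const_mul (z : ℂ) (m : ℤ × ℤ → ℂ) (a b c : ℤ → ℂ) :
    tri (fun p => z * m p) a b c = z * tri m a b c := by
  rw [tri, tri, ← tsum_mul_left]
  exact tsum_congr fun p => by ring

theorem tri_swap (m : ℤ × ℤ → ℂ) (a b c : ℤ → ℂ) :
    tri (fun p => m (p.2, p.1)) b a c = tri m a b c := by
  rw [tri, tri, ← (Equiv.prodComm ℤ ℤ).tsum_eq]
  refine tsum_congr fun p => ?_
  simp only [Equiv.prodComm_apply, Prod.fst_swap, Prod.snd_swap]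
  rw [show -p.2 - p.1 = -p.1 - p.2 by ring, mul_comm (b _)]

theorem tri_rot (m : ℤ × ℤ → ℂ) (a b c : ℤ → ℂ) :
    tri (fun p => m (p.2, -p.1 - p.2)) c a b = tri m a b c := by
  symm
  rw [tri, tri, ← rot.tsum_eq]
  refine tsum_congr fun p => ?_
  simp only [rot, Equiv.coe_fn_mk, third_rot]; ring

/-- A sequence of Fourier coefficients of a real function. -/
def Herm (a : ℤ → ℂ) : Prop := ∀ k, a (-k) = (starRingEnd ℂ) (a k)

/-- Hermitian symmetry turns `conj (a k)` into `a (-k)`, which makes the pairing a sum over resonant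
triples; the reflection `k ↦ -k` of the odd weight produces the sign. -/
theorem tsum_odd_pairing {wt : ℤ → ℂ} (hw : ∀ k, wt (-k) = -wt k) {a b : ℤ → ℂ} (ha : Herm a)
    {B : ℝ} (h : TriLE (fun p => wt p.1) a a b B) :
    ∑' k : ℤ, wt k * ((starRingEnd ℂ) (a k) * conv a b k) = -tri (fun p => wt p.1) a a b := by
  have hs : Summable fun p : ℤ × ℤ => a p.1 * b p.2 * (wt (-p.1 - p.2) * a (-p.1 - p.2)) := by
    refine rot.summable_iff.1 (h.summable.congr fun p => ?_)
    simp only [Function.comp_apply, rot_fst, rot_snd, third_rot]; ring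
  have h1 := tsum_tri_eq (c := fun k => wt k * a k) hs
  have h2 : tri (fun p => wt p.1) a a b = ∑' k : ℤ, wt k * a k * conv a b (-k) := by
    refine Eq.trans ?_ h1
    refine Eq.trans ?_
      (rot.tsum_eq fun p : ℤ × ℤ => a p.1 * b p.2 * (wt (-p.1 - p.2) * a (-p.1 - p.2)))
    refine tsum_congr fun p => ?_
    simp only [rot_fst, rot_snd, third_rot]; ring
  have h3 := (Equiv.neg ℤ).tsum_eq fun k : ℤ => wt k * a k * conv a b (-k)
  rw [h2, ← h3, ← tsum_neg]
  refine tsum_congr fun k => ?_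
  simp only [Equiv.neg_apply]
  rw [hw, ha k, neg_neg]; ring

/-- Three derivatives on an `H²` factor would be one too many. Since `|k₁| ≤ |k₂| + |k₃|`, one of
them moves to another factor. -/
theorem triLE_cube {a b c : ℤ → ℂ} {A₂ B₀ B₁ C₀ C₁ : ℝ}
    (ha : L2Le (fun k : ℤ => |(k : ℝ)| * (|(k : ℝ)| * ‖a k‖)) A₂)
    (hb : SumLE (fun k => ‖b k‖) B₀) (hb1 : SumLE (fun k : ℤ => |(k : ℝ)| * ‖b k‖) B₁)
    (hc : L2Le (fun k => ‖c k‖) C₀) (hc1 : L2Le (fun k : ℤ => |(k : ℝ)| * ‖c k‖) C₁) :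
    TriLE (fun p => (p.1 : ℂ) ^ 3) a b c (A₂ * B₁ * C₀ + A₂ * B₀ * C₁) := by
  have h1 := sumLE_tri ha hb1 hc (fun _ => by positivity) (fun _ => by positivity)
    (fun _ => by positivity)
  have h2 := sumLE_tri ha hb hc1 (fun _ => by positivity) (fun _ => by positivity)
    (fun _ => by positivity)
  refine (h1.add h2).mono fun p => ?_
  have hn : ‖(p.1 : ℂ) ^ 3‖ = |(p.1 : ℝ)| ^ 3 := by
    rw [norm_pow, Complex.norm_intCast]
  have h3 : |(p.1 : ℝ)| ≤ |(p.2 : ℝ)| + |((-p.1 - p.2 : ℤ) : ℝ)| := by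
    rw [show (p.1 : ℝ) = -((p.2 : ℝ) + ((-p.1 - p.2 : ℤ) : ℝ)) by push_cast; ring, abs_neg]
    exact abs_add_le _ _
  rw [hn]
  have h4 : 0 ≤ |(p.1 : ℝ)| ^ 2 * (‖a p.1‖ * ‖b p.2‖ * ‖c (-p.1 - p.2)‖) := by positivity
  calc _ = |(p.1 : ℝ)| * (|(p.1 : ℝ)| ^ 2 * (‖a p.1‖ * ‖b p.2‖ * ‖c (-p.1 - p.2)‖)) := by ring
    _ ≤ (|(p.2 : ℝ)| + |((-p.1 - p.2 : ℤ) : ℝ)|) *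
        (|(p.1 : ℝ)| ^ 2 * (‖a p.1‖ * ‖b p.2‖ * ‖c (-p.1 - p.2)‖)) :=
      mul_le_mul_of_nonneg_right h3 h4
    _ = _ := by ring

/-! ### Evolution of Fourier coefficients under the Airy equation with a remainder -/

/-- The Fourier coefficients `a` of a real mean-free function, bounded in `H²` locally in time,
evolve by `a' = i k³ a + r`. -/
structure Evol (a r : ℝ → ℤ → ℂ) : Prop where
  zero : ∀ t, 0 < t → a t 0 = 0
  herm : ∀ t, 0 < t → Herm (a t)
  bdd : ∀ T, ∃ B, ∀ t, 0 < t → t ≤ T →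
    L2Le (fun k : ℤ => |(k : ℝ)| * (|(k : ℝ)| * ‖a t k‖)) B
  deriv : ∀ k t, 0 < t → HasDerivAt (fun t => a t k) (I * (k : ℂ) ^ 3 * a t k + r t k) t
  cont : ∀ k, ContinuousOn (fun t => r t k) (Set.Ioi 0)
  bdd_rem : ∀ T, ∃ B, ∀ t, 0 < t → t ≤ T → L2Le (fun k => ‖r t k‖) B

/-- `a` is bounded by `B` in `H²` and in the spaces into which `H²` embeds. -/
structure H2Bound (a : ℤ → ℂ) (B : ℝ) : Prop where
  l2₂ : L2Le (fun k : ℤ => |(k : ℝ)| * (|(k : ℝ)| * ‖a k‖)) B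
  l2₁ : L2Le (fun k : ℤ => |(k : ℝ)| * ‖a k‖) B
  l2 : L2Le (fun k => ‖a k‖) B
  l1₁ : SumLE (fun k : ℤ => |(k : ℝ)| * ‖a k‖) B
  l1 : SumLE (fun k => ‖a k‖) B

theorem H2Bound.of_weighted {a : ℤ → ℂ} {A : ℝ} (h0 : a 0 = 0)
    (h : L2Le (fun k : ℤ => |(k : ℝ)| * (|(k : ℝ)| * ‖a k‖)) A) :
    H2Bound a (A + embConst * A) := by
  have hc : 0 ≤ embConst * A := mul_nonneg embConst_nonneg h.1
  have h1 : A ≤ A + embConst * A := by linarith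
  have h2 : embConst * A ≤ A + embConst * A := by linarith [h.1]
  have g1 := h.of_weighted (fun _ => by positivity) (by simp)
  have g2 := g1.of_weighted (fun _ => by positivity) (by simp [h0])
  exact ⟨h.le_of_le h1, g1.le_of_le h1, g2.le_of_le h1,
    (h.sumLE_of_weighted (by simp)).le_of_le h2,
    (g1.sumLE_of_weighted (by simp [h0])).le_of_le h2⟩

namespace Evol

variable {a b r s : ℝ → ℤ → ℂ}

theorem h2Bound (h : Evol a r) (T : ℝ) : ∃ B, ∀ t, 0 < t → t ≤ T → H2Bound (a t) B := by
  obtain ⟨B, hB⟩ := h.bdd T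
  exact ⟨_, fun t ht hT => H2Bound.of_weighted (h.zero t ht) (hB t ht hT)⟩

theorem continuousOn (h : Evol a r) (k : ℤ) : ContinuousOn (fun t => a t k) (Set.Ioi 0) :=
  fun t ht => (h.deriv k t ht).continuousAt.continuousWithinAt

theorem lincomb (ha : Evol a r) (hb : Evol b s) (x y : ℝ) :
    Evol (fun t k => x * a t k + y * b t k) (fun t k => x * r t k + y * s t k) where
  zero t ht := by simp [ha.zero t ht, hb.zero t ht]
  herm t ht k := by simp [ha.herm t ht k, hb.herm t ht k]
  bdd T := by
    obtain ⟨A, hA⟩ := ha.bdd T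
    obtain ⟨B, hB⟩ := hb.bdd T
    refine ⟨|x| * A + |y| * B, fun t ht hT => ?_⟩
    refine (((hA t ht hT).const_mul (abs_nonneg x)).add
      ((hB t ht hT).const_mul (abs_nonneg y))).mono (fun k => by positivity) fun k => ?_
    have : ‖(x : ℂ) * a t k + y * b t k‖ ≤ |x| * ‖a t k‖ + |y| * ‖b t k‖ := by
      refine (norm_add_le _ _).trans (le_of_eq ?_)
      simp
    calc _ ≤ |(k : ℝ)| * (|(k : ℝ)| * (|x| * ‖a t k‖ + |y| * ‖b t k‖)) := by gcongr
      _ = _ := by ring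
  deriv k t ht := by
    refine (((ha.deriv k t ht).const_mul (x : ℂ)).add
      ((hb.deriv k t ht).const_mul (y : ℂ))).congr_deriv ?_
    ring
  cont k := (continuousOn_const.mul (ha.cont k)).add (continuousOn_const.mul (hb.cont k))
  bdd_rem T := by
    obtain ⟨A, hA⟩ := ha.bdd_rem T
    obtain ⟨B, hB⟩ := hb.bdd_rem T
    refine ⟨|x| * A + |y| * B, fun t ht hT => ?_⟩
    refine (((hA t ht hT).const_mul (abs_nonneg x)).add
      ((hB t ht hT).const_mul (abs_nonneg y))).mono (fun k => by positivity) fun k => ?_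
    refine (norm_add_le _ _).trans (le_of_eq ?_)
    simp

/-- The rate of change of a weighted sum of squares. -/
theorem hasRate_sq (h : Evol a r) {j : ℕ} (hj : j ≤ 1) :
    HasRate (fun t => ∑' k : ℤ, (|(k : ℝ)| ^ j * ‖a t k‖) ^ 2)
      (fun t => ∑' k : ℤ, 2 * (k : ℝ) ^ (2 * j) * ((starRingEnd ℂ) (a t k) * r t k).re) := by
  have hw : ∀ k : ℤ, ((k : ℝ)) ^ (2 * j) = (|(k : ℝ)| ^ j) ^ 2 := fun k => by
    rw [← pow_mul, mul_comm j 2, pow_mul, pow_mul, sq_abs]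
  refine hasRate_tsum (X := fun (k : ℤ) t => (|(k : ℝ)| ^ j * ‖a t k‖) ^ 2)
    (Y := fun (k : ℤ) t => 2 * (k : ℝ) ^ (2 * j) * ((starRingEnd ℂ) (a t k) * r t k).re) ?_ ?_ ?_ ?_
  · intro k t ht
    have h1 := h.deriv k t ht
    have hre : HasDerivAt (fun t => (a t k).re) _ t := (Complex.reCLM.hasFDerivAt.comp_hasDerivAt t h1)
    have him : HasDerivAt (fun t => (a t k).im) _ t := (Complex.imCLM.hasFDerivAt.comp_hasDerivAt t h1)
    have h2 := ((hre.pow 2).add (him.pow 2)).const_mul ((k : ℝ) ^ (2 * j))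
    refine (h2.congr_of_eventuallyEq (Eventually.of_forall fun τ => ?_)).congr_deriv ?_
    · simp only [Pi.add_apply, Pi.pow_apply]
      rw [mul_pow, ← hw, ← Complex.normSq_eq_norm_sq, Complex.normSq_apply]
      ring
    · simp only [Complex.reCLM_apply, Complex.imCLM_apply, Complex.add_re, Complex.add_im,
        Complex.mul_re, Complex.mul_im, Complex.I_re, Complex.I_im, Complex.conj_re,
        Complex.conj_im]
      have e1 : ((k : ℂ) ^ 3).im = 0 := by exact_mod_cast Complex.ofReal_im ((k : ℝ) ^ 3)
      rw [e1]
      push_cast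
      ring
  · intro k
    refine continuousOn_const.mul (Complex.continuous_re.comp_continuousOn ?_)
    exact (Complex.continuous_conj.comp_continuousOn (h.continuousOn k)).mul (h.cont k)
  · intro t ht
    obtain ⟨B, hB⟩ := h.h2Bound t
    have h1 := hB t ht le_rfl
    interval_cases j
    · simpa using h1.l2.summable
    · simpa using h1.l2₁.summable
  · intro T
    obtain ⟨B, hB⟩ := h.h2Bound T
    obtain ⟨B', hB'⟩ := h.bdd_rem T
    refine ⟨2 * (B * B'), fun t ht hT => ?_⟩
    have h1 := hB t ht hT
    have h2 := (h1.l2₂.sum_mul_le (hB' t ht hT)).const_mul (c := 2) (by norm_num)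
    refine h2.mono fun k => ?_
    have h3 : |((starRingEnd ℂ) (a t k) * r t k).re| ≤ ‖a t k‖ * ‖r t k‖ := by
      refine (Complex.abs_re_le_norm _).trans (le_of_eq ?_)
      simp
    have h4 : (|(k : ℝ)| ^ j) ^ 2 * ‖a t k‖ ≤ |(k : ℝ)| * (|(k : ℝ)| * ‖a t k‖) := by
      by_cases hk : k = 0
      · simp [hk, h.zero t ht]
      · have : |(k : ℝ)| ^ j ≤ |(k : ℝ)| := by
          simpa using pow_le_pow_right₀ (one_le_abs_intCast hk) hj
        calc _ ≤ |(k : ℝ)| ^ 2 * ‖a t k‖ := by gcongr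
          _ = _ := by ring
    rw [hw, Real.norm_eq_abs, abs_mul, abs_of_nonneg (by positivity : 0 ≤ 2 * (|(k : ℝ)| ^ j) ^ 2)]
    calc _ ≤ 2 * (|(k : ℝ)| ^ j) ^ 2 * (‖a t k‖ * ‖r t k‖) := by gcongr
      _ = 2 * ((|(k : ℝ)| ^ j) ^ 2 * ‖a t k‖ * ‖r t k‖) := by ring
      _ ≤ _ := by gcongr

/-- The rate of change of a trilinear functional. -/
theorem hasRate_tri {c u : ℝ → ℤ → ℂ} (ha : Evol a r) (hb : Evol b s) (hc : Evol c u)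
    (m : ℤ × ℤ → ℂ) (h0 : ∀ t, 0 < t → ∃ B, TriLE m (a t) (b t) (c t) B)
    (hd : ∀ T, ∃ B, ∀ t, 0 < t → t ≤ T → TriLE (fun p => I * (m p *
      ((p.1 : ℂ) ^ 3 + (p.2 : ℂ) ^ 3 + ((-p.1 - p.2 : ℤ) : ℂ) ^ 3))) (a t) (b t) (c t) B)
    (h1 : ∀ T, ∃ B, ∀ t, 0 < t → t ≤ T → TriLE m (r t) (b t) (c t) B)
    (h2 : ∀ T, ∃ B, ∀ t, 0 < t → t ≤ T → TriLE m (a t) (s t) (c t) B)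
    (h3 : ∀ T, ∃ B, ∀ t, 0 < t → t ≤ T → TriLE m (a t) (b t) (u t) B) :
    HasRate (fun t => tri m (a t) (b t) (c t)) (fun t => tri (fun p => I * (m p *
      ((p.1 : ℂ) ^ 3 + (p.2 : ℂ) ^ 3 + ((-p.1 - p.2 : ℤ) : ℂ) ^ 3))) (a t) (b t) (c t)
      + (tri m (r t) (b t) (c t) + tri m (a t) (s t) (c t) + tri m (a t) (b t) (u t))) := by
  set M : ℤ × ℤ → ℂ := fun p => I * (m p *
      ((p.1 : ℂ) ^ 3 + (p.2 : ℂ) ^ 3 + ((-p.1 - p.2 : ℤ) : ℂ) ^ 3)) with hM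
  have key := hasRate_tsum (X := fun p t => m p * (a t p.1 * b t p.2 * c t (-p.1 - p.2)))
    (Y := fun p t => M p * (a t p.1 * b t p.2 * c t (-p.1 - p.2)) +
      (m p * (r t p.1 * b t p.2 * c t (-p.1 - p.2)) + m p * (a t p.1 * s t p.2 * c t (-p.1 - p.2))
        + m p * (a t p.1 * b t p.2 * u t (-p.1 - p.2)))) ?_ ?_ ?_ ?_
  · refine key.congr fun t ht => ?_
    obtain ⟨B, hB⟩ := hd t
    obtain ⟨B1, hB1⟩ := h1 t
    obtain ⟨B2, hB2⟩ := h2 t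
    obtain ⟨B3, hB3⟩ := h3 t
    have s0 := (hB t ht le_rfl).summable
    have s1 := (hB1 t ht le_rfl).summable
    have s2 := (hB2 t ht le_rfl).summable
    have s3 := (hB3 t ht le_rfl).summable
    simp only [tri]
    rw [s0.tsum_add ((s1.add s2).add s3), (s1.add s2).tsum_add s3, s1.tsum_add s2]
  · intro p t ht
    have d := (((ha.deriv p.1 t ht).mul (hb.deriv p.2 t ht)).mul
      (hc.deriv (-p.1 - p.2) t ht)).const_mul (m p)
    refine d.congr_deriv ?_
    simp only [hM, Pi.mul_apply]
    ring
  · intro p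
    have a1 := ha.continuousOn p.1
    have a2 := hb.continuousOn p.2
    have a3 := hc.continuousOn (-p.1 - p.2)
    have a4 := ha.cont p.1
    have a5 := hb.cont p.2
    have a6 := hc.cont (-p.1 - p.2)
    fun_prop
  · intro t ht
    obtain ⟨B, hB⟩ := h0 t ht
    exact hB.summable
  · intro T
    obtain ⟨B, hB⟩ := hd T
    obtain ⟨B1, hB1⟩ := h1 T
    obtain ⟨B2, hB2⟩ := h2 T
    obtain ⟨B3, hB3⟩ := h3 T
    refine ⟨B + (B1 + B2 + B3), fun t ht hT => ?_⟩
    refine ((hB t ht hT).sumLE_norm.add (((hB1 t ht hT).sumLE_norm.add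
      (hB2 t ht hT).sumLE_norm).add (hB3 t ht hT).sumLE_norm)).mono fun p => ?_
    exact (norm_add_le _ _).trans (by gcongr; exact norm_add₃_le)

end Evol

/-! ### Solutions in Fourier variables -/

/-- The non-dispersive part of the Korteweg--de Vries vector field in Fourier variables. -/
noncomputable def kdvRem (γ : ℝ) (f a : ℤ → ℂ) (k : ℤ) : ℂ :=
  -γ * a k + f k - I * (1 / 2 : ℝ) * k * conv a a k

/-- The Fourier coefficients of a real mean-free force, bounded by `Φ` in `H¹`. -/
structure Force (f : ℤ → ℂ) (Φ : ℝ) : Prop where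
  zero : f 0 = 0
  herm : Herm f
  l2₁ : L2Le (fun k : ℤ => |(k : ℝ)| * ‖f k‖) Φ

theorem Force.l2 {f : ℤ → ℂ} {Φ : ℝ} (h : Force f Φ) : L2Le (fun k => ‖f k‖) Φ :=
  h.l2₁.of_weighted (fun _ => norm_nonneg _) (by simp [h.zero])

/-- The Fourier coefficients of an `H²` solution of the damped-driven equation. -/
structure Orbit (γ : ℝ) (f : ℤ → ℂ) (a : ℝ → ℤ → ℂ) : Prop where
  zero : ∀ t, 0 < t → a t 0 = 0
  herm : ∀ t, 0 < t → Herm (a t)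
  bdd : ∀ T, ∃ B, ∀ t, 0 < t → t ≤ T →
    L2Le (fun k : ℤ => |(k : ℝ)| * (|(k : ℝ)| * ‖a t k‖)) B
  deriv : ∀ k t, 0 < t →
    HasDerivAt (fun t => a t k) (I * (k : ℂ) ^ 3 * a t k + kdvRem γ f (a t) k) t

/-- Weierstrass test: the `H²` bound dominates the `j`-th term of the convolution by a constant
times `1 / j²`, uniformly in time. -/
theorem continuousOn_conv_self {a : ℝ → ℤ → ℂ} {S : Set ℝ}
    (hc : ∀ k, ContinuousOn (fun t => a t k) S) (h0 : ∀ t ∈ S, a t 0 = 0) {B : ℝ}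
    (hB : ∀ t ∈ S, L2Le (fun k : ℤ => |(k : ℝ)| * (|(k : ℝ)| * ‖a t k‖)) B) (k : ℤ) :
    ContinuousOn (fun t => conv (a t) (a t) k) S := by
  have hsum := l2Le_inv_abs.summable.mul_left (B * (B + embConst * B))
  refine continuousOn_tsum (fun j => (hc j).mul (hc (k - j))) hsum fun j t ht => ?_
  have hb := H2Bound.of_weighted (h0 t ht) (hB t ht)
  rw [norm_mul]
  have h1 := hb.l2.le_apply (k - j)
  by_cases hj : j = 0
  · simp [hj, h0 t ht]
  · have hj' : 0 < |(j : ℝ)| := by simpa using hj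
    have h2 : ‖a t j‖ ≤ B * (1 / |(j : ℝ)|) ^ 2 := by
      have := (hB t ht).le_apply j
      rw [div_pow, one_pow, mul_one_div, le_div_iff₀ (by positivity)]
      linarith
    calc _ ≤ (B * (1 / |(j : ℝ)|) ^ 2) * (B + embConst * B) :=
          mul_le_mul h2 h1 (norm_nonneg _) (mul_nonneg (hB t ht).1 (sq_nonneg _))
      _ = _ := by ring

theorem norm_kdvRem_le (γ : ℝ) (f a : ℤ → ℂ) (k : ℤ) :
    ‖kdvRem γ f a k‖ ≤ |γ| * ‖a k‖ + ‖f k‖ + |(k : ℝ)| * ‖conv a a k‖ := by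
  have h1 : ‖-(γ : ℂ) * a k‖ = |γ| * ‖a k‖ := by simp
  have h2 : ‖I * ((1 / 2 : ℝ) : ℂ) * k * conv a a k‖ ≤ |(k : ℝ)| * ‖conv a a k‖ := by
    rw [norm_mul, norm_mul, norm_mul, Complex.norm_I, Complex.norm_real, Complex.norm_intCast,
      Real.norm_eq_abs]
    have : 0 ≤ |(k : ℝ)| * ‖conv a a k‖ := by positivity
    rw [abs_of_pos (by norm_num : (0 : ℝ) < 1 / 2)]
    linarith
  rw [kdvRem]
  refine (norm_sub_le _ _).trans (add_le_add ((norm_add_le _ _).trans ?_) h2)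
  rw [h1]

theorem H2Bound.conv_self {a : ℤ → ℂ} {B : ℝ} (h : H2Bound a B) :
    L2Le (fun k : ℤ => |(k : ℝ)| * ‖conv a a k‖) (B * B + B * B) :=
  l2Le_abs_mul_conv h.l2 h.l1 h.l1 h.l2₁ h.l2₁

theorem H2Bound.l2Le_kdvRem {a f : ℤ → ℂ} {B Φ : ℝ} (h : H2Bound a B)
    (hf : L2Le (fun k => ‖f k‖) Φ) (γ : ℝ) :
    L2Le (fun k => ‖kdvRem γ f a k‖) (|γ| * B + Φ + (B * B + B * B)) :=
  (((h.l2.const_mul (abs_nonneg γ)).add hf).add h.conv_self).mono (fun _ => norm_nonneg _)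
    (norm_kdvRem_le γ f a)

theorem Orbit.evol {γ : ℝ} {f : ℤ → ℂ} {a : ℝ → ℤ → ℂ} {Φ : ℝ} (h : Orbit γ f a)
    (hf : Force f Φ) : Evol a (fun t => kdvRem γ f (a t)) where
  zero := h.zero
  herm := h.herm
  bdd := h.bdd
  deriv := h.deriv
  cont k := by
    have hc : ∀ k, ContinuousOn (fun t => a t k) (Set.Ioi 0) := fun k t ht =>
      (h.deriv k t ht).continuousAt.continuousWithinAt
    have hconv : ContinuousOn (fun t => conv (a t) (a t) k) (Set.Ioi 0) := by
      intro t ht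
      obtain ⟨B, hB⟩ := h.bdd (t + 1)
      have hS : Set.Ioo 0 (t + 1) ⊆ Set.Ioi 0 := fun x hx => hx.1
      have h1 := continuousOn_conv_self (S := Set.Ioo 0 (t + 1)) (fun k => (hc k).mono hS)
        (fun t ht => h.zero t ht.1) (fun t ht => hB t ht.1 ht.2.le) k
      exact (h1.continuousAt (Ioo_mem_nhds ht (lt_add_one t))).continuousWithinAt
    unfold kdvRem
    exact ((continuousOn_const.mul (hc k)).add continuousOn_const).sub
      (continuousOn_const.mul hconv)
  bdd_rem T := by
    obtain ⟨B, hB⟩ := h.bdd T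
    exact ⟨_, fun t ht hT =>
      (H2Bound.of_weighted (h.zero t ht) (hB t ht hT)).l2Le_kdvRem hf.l2 γ⟩

/-! ### Energy identities -/

/-- One identity serves both uses: `κ = 1/2`, `b = a` for a single solution, and `κ = 1`, `b` the
mean, `f = 0` for a difference. The index `j` selects the `L²` or the `H¹` balance. -/
theorem quadratic_rate_eq {γ κ : ℝ} {j : ℕ} {a b f : ℤ → ℂ} (ha : Herm a)
    (h1 : Summable fun k : ℤ => (|(k : ℝ)| ^ j * ‖a k‖) ^ 2)
    (h2 : Summable fun k : ℤ => (k : ℂ) ^ (2 * j) * ((starRingEnd ℂ) (a k) * f k))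
    (h3 : Summable fun k : ℤ => (k : ℂ) ^ (2 * j + 1) * ((starRingEnd ℂ) (a k) * conv a b k))
    {B : ℝ} (h4 : TriLE (fun p => (p.1 : ℂ) ^ (2 * j + 1)) a a b B) :
    ∑' k : ℤ, 2 * (k : ℝ) ^ (2 * j) * ((starRingEnd ℂ) (a k) *
      (-γ * a k + f k - I * κ * k * conv a b k)).re
    = -2 * γ * ∑' k : ℤ, (|(k : ℝ)| ^ j * ‖a k‖) ^ 2
      + 2 * (∑' k : ℤ, (k : ℂ) ^ (2 * j) * ((starRingEnd ℂ) (a k) * f k)).re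
      + 2 * κ * (I * tri (fun p => (p.1 : ℂ) ^ (2 * j + 1)) a a b).re := by
  have h5 := tsum_odd_pairing (wt := fun k => (k : ℂ) ^ (2 * j + 1))
    (fun k => by push_cast; rw [Odd.neg_pow ⟨j, rfl⟩]) ha h4
  have h6 : (I * tri (fun p => (p.1 : ℂ) ^ (2 * j + 1)) a a b).re
      = ∑' k : ℤ, (-I * ((k : ℂ) ^ (2 * j + 1) * ((starRingEnd ℂ) (a k) * conv a b k))).re := by
    rw [← Complex.re_tsum (h3.mul_left _), tsum_mul_left, h5]
    ring_nf
  rw [h6, Complex.re_tsum h2, ← tsum_mul_left, ← tsum_mul_left, ← tsum_mul_left]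
  have s1 := h1.mul_left (-2 * γ)
  have s2 := (Complex.hasSum_re h2.hasSum).summable.mul_left 2
  have s3 := (Complex.hasSum_re (h3.mul_left (-I)).hasSum).summable.mul_left (2 * κ)
  rw [← s1.tsum_add s2, ← (s1.add s2).tsum_add s3]
  refine tsum_congr fun k => ?_
  have e1 : (k : ℂ) ^ (2 * j) = (((k : ℝ) ^ (2 * j) : ℝ) : ℂ) := by push_cast; rfl
  have e2 : (k : ℂ) ^ (2 * j + 1) = (((k : ℝ) ^ (2 * j + 1) : ℝ) : ℂ) := by push_cast; rfl
  have e3 : (|(k : ℝ)| ^ j * ‖a k‖) ^ 2 = (k : ℝ) ^ (2 * j) * ‖a k‖ ^ 2 := by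
    rw [mul_pow, ← pow_mul, mul_comm j 2, pow_mul, sq_abs, ← pow_mul]
  have e4 : (k : ℂ) = ((k : ℝ) : ℂ) := by push_cast; rfl
  rw [e1, e2, e3, e4, ← Complex.normSq_eq_norm_sq, Complex.normSq_apply]
  simp only [Complex.mul_re, Complex.mul_im, Complex.conj_re, Complex.conj_im, Complex.sub_re,
    Complex.sub_im, Complex.add_re, Complex.add_im, Complex.neg_re, Complex.neg_im,
    Complex.ofReal_re, Complex.ofReal_im, Complex.I_re, Complex.I_im]
  ring

theorem triLE_const {a b c : ℤ → ℂ} {A B C : ℝ} (ha : L2Le (fun k => ‖a k‖) A)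
    (hb : SumLE (fun k => ‖b k‖) B) (hc : L2Le (fun k => ‖c k‖) C) (z : ℂ) :
    TriLE (fun _ => z) a b c (‖z‖ * (A * B * C)) :=
  (sumLE_tri ha hb hc (fun _ => norm_nonneg _) (fun _ => norm_nonneg _)
    (fun _ => norm_nonneg _)).const_mul (norm_nonneg z)

theorem triLE_fst {a b c : ℤ → ℂ} {A B C : ℝ} (ha : L2Le (fun k : ℤ => |(k : ℝ)| * ‖a k‖) A)
    (hb : SumLE (fun k => ‖b k‖) B) (hc : L2Le (fun k => ‖c k‖) C) :
    TriLE (fun p => (p.1 : ℂ)) a b c (A * B * C) :=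
  (sumLE_tri ha hb hc (fun _ => by positivity) (fun _ => norm_nonneg _)
    (fun _ => norm_nonneg _)).mono fun p => le_of_eq (by rw [Complex.norm_intCast]; ring)

/-- The quadratic nonlinearity conserves the `L²` norm. -/
theorem tri_fst_self {a : ℤ → ℂ} {B : ℝ} (h : TriLE (fun p => (p.1 : ℂ)) a a a B) :
    tri (fun p => (p.1 : ℂ)) a a a = 0 := by
  have h1 := h.rot
  have h2 := h.rot.rot
  have e1 := tri_rot (fun p => (p.1 : ℂ)) a a a
  have e2 := tri_rot (fun p => (p.2 : ℂ)) a a a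
  have e3 := h1.tri_add h2
  have e4 := (h.add h1).tri_add h2
  rw [h.tri_add h1] at e4
  simp only at e1 e2 e4
  rw [e1, e2, e1] at e4
  -- Averaging the symbol over cyclic rotations replaces `k₁` by a third of `k₁ + k₂ + k₃`, which
  -- vanishes on resonant triples.
  have e5 : tri (fun p : ℤ × ℤ => (p.1 : ℂ) + (p.2 : ℂ) + ((-p.1 - p.2 : ℤ) : ℂ)) a a a = 0 := by
    unfold tri
    rw [← tsum_zero (α := ℂ) (β := ℤ × ℤ)]
    refine tsum_congr fun p => ?_
    push_cast
    ring
  rw [e5] at e4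
  linear_combination (-1 / 3 : ℂ) * e4

theorem tri_cube_self {a : ℤ → ℂ} {B : ℝ} (h : TriLE (fun p => (p.1 : ℂ) ^ 3) a a a B) :
    tri (fun p => (p.1 : ℂ) ^ 3 + (p.2 : ℂ) ^ 3 + ((-p.1 - p.2 : ℤ) : ℂ) ^ 3) a a a
      = 3 * tri (fun p => (p.1 : ℂ) ^ 3) a a a := by
  have e1 := tri_rot (fun p => (p.1 : ℂ) ^ 3) a a a
  have e2 := tri_rot (fun p => (p.2 : ℂ) ^ 3) a a a
  have e4 := (h.add h.rot).tri_add h.rot.rot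
  rw [h.tri_add h.rot] at e4
  simp only at e1 e2 e4
  rw [e1, e2, e1] at e4
  rw [e4]
  ring

/-- The identity `∫ u² D(u²) = 0`. -/
theorem tri_self_conv {a : ℤ → ℂ} {B : ℝ}
    (h : TriLE (fun _ => 1) a a (fun k => (k : ℂ) * conv a a k) B) :
    tri (fun _ => 1) a a (fun k => (k : ℂ) * conv a a k) = 0 := by
  have h1 := tsum_tri_eq (c := fun k : ℤ => (k : ℂ) * conv a a k)
    (h.summable.congr fun p => one_mul _)
  have h2 : tri (fun _ => 1) a a (fun k => (k : ℂ) * conv a a k)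
      = ∑' k : ℤ, (k : ℂ) * conv a a k * conv a a (-k) := by
    rw [← h1]
    exact tsum_congr fun p => one_mul _
  have h3 := (Equiv.neg ℤ).tsum_eq fun k : ℤ => (k : ℂ) * conv a a k * conv a a (-k)
  have h4 : ∑' k : ℤ, (((Equiv.neg ℤ) k : ℤ) : ℂ) * conv a a ((Equiv.neg ℤ) k)
      * conv a a (-(Equiv.neg ℤ) k) = -∑' k : ℤ, (k : ℂ) * conv a a k * conv a a (-k) := by
    rw [← tsum_neg]
    refine tsum_congr fun k => ?_
    simp only [Equiv.neg_apply, neg_neg]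
    push_cast
    ring
  rw [h4] at h3
  rw [h2]
  linear_combination (-1 / 2 : ℂ) * h3

theorem abs_pow_le_sq {j : ℕ} (hj : j ≤ 1) {k : ℤ} (hk : k ≠ 0) :
    |(k : ℝ)| ^ (2 * j) ≤ |(k : ℝ)| * |(k : ℝ)| := by
  rw [← pow_two]
  exact pow_le_pow_right₀ (one_le_abs_intCast hk) (by omega)

/-- For `j = 1` both derivatives go on the `H²` factor, so the other one needs only `ℓ²`; nonlinear
remainders have no more regularity than that. -/
theorem summable_weighted_pairing {a b : ℤ → ℂ} {A B : ℝ} (h0 : a 0 = 0)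
    (ha : L2Le (fun k : ℤ => |(k : ℝ)| * (|(k : ℝ)| * ‖a k‖)) A) (hb : L2Le (fun k => ‖b k‖) B)
    {j : ℕ} (hj : j ≤ 1) :
    Summable fun k : ℤ => (k : ℂ) ^ (2 * j) * ((starRingEnd ℂ) (a k) * b k) := by
  refine SumLE.summable_of_norm (B := A * B) ((ha.sum_mul_le hb).mono fun k => ?_)
  rw [norm_mul, norm_mul, norm_pow, Complex.norm_intCast, RCLike.norm_conj, ← mul_assoc]
  refine mul_le_mul_of_nonneg_right ?_ (norm_nonneg _)
  by_cases hk : k = 0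
  · simp [hk, h0]
  · rw [← mul_assoc]
    exact mul_le_mul_of_nonneg_right (abs_pow_le_sq hj hk) (norm_nonneg _)

theorem norm_weighted_pairing_le {a b : ℤ → ℂ} {A B : ℝ} {j : ℕ}
    (ha : L2Le (fun k : ℤ => |(k : ℝ)| ^ j * ‖a k‖) A)
    (hb : L2Le (fun k : ℤ => |(k : ℝ)| ^ j * ‖b k‖) B) :
    ‖∑' k : ℤ, (k : ℂ) ^ (2 * j) * ((starRingEnd ℂ) (a k) * b k)‖ ≤ A * B := by
  refine SumLE.norm_tsum_le ((ha.sum_mul_le hb).mono fun k => le_of_eq ?_)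
  rw [norm_mul, norm_mul, norm_pow, Complex.norm_intCast, RCLike.norm_conj]
  ring

theorem quadratic_rate {γ κ : ℝ} {j : ℕ} (hj : j ≤ 1) {a b f : ℤ → ℂ} (ha : Herm a)
    (h0 : a 0 = 0) {A B Φ : ℝ} (hA : H2Bound a A) (hB : H2Bound b B)
    (hf : L2Le (fun k => ‖f k‖) Φ) :
    ∑' k : ℤ, 2 * (k : ℝ) ^ (2 * j) * ((starRingEnd ℂ) (a k) *
      (-γ * a k + f k - I * κ * k * conv a b k)).re
    = -2 * γ * ∑' k : ℤ, (|(k : ℝ)| ^ j * ‖a k‖) ^ 2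
      + 2 * (∑' k : ℤ, (k : ℂ) ^ (2 * j) * ((starRingEnd ℂ) (a k) * f k)).re
      + 2 * κ * (I * tri (fun p => (p.1 : ℂ) ^ (2 * j + 1)) a a b).re := by
  have hconv := l2Le_abs_mul_conv hA.l2 hB.l1 hA.l1 hA.l2₁ hB.l2₁
  have hconv' : L2Le (fun k : ℤ => ‖(k : ℂ) * conv a b k‖) (A * B + B * A) := by
    simpa only [norm_mul, Complex.norm_intCast] using hconv
  have h3 := (summable_weighted_pairing h0 hA.l2₂ hconv' hj).congr
    (g := fun k : ℤ => (k : ℂ) ^ (2 * j + 1) * ((starRingEnd ℂ) (a k) * conv a b k))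
    fun k => by ring
  have h2 := summable_weighted_pairing h0 hA.l2₂ hf hj
  interval_cases j
  · exact quadratic_rate_eq ha (by simpa using hA.l2.summable) h2 h3
      (by simpa using triLE_fst hA.l2₁ hA.l1 hB.l2)
  · exact quadratic_rate_eq ha (by simpa using hA.l2₁.summable) h2 h3
      (by simpa using triLE_cube hA.l2₂ hA.l1 hA.l1₁ hB.l2 hB.l2₁)

/-! ### Absorbing balls -/

theorem Orbit.h2Bound {γ : ℝ} {f : ℤ → ℂ} {a : ℝ → ℤ → ℂ} (h : Orbit γ f a) {t : ℝ}
    (ht : 0 < t) : ∃ B, H2Bound (a t) B := by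
  obtain ⟨B, hB⟩ := h.bdd t
  exact ⟨_, H2Bound.of_weighted (h.zero t ht) (hB t ht le_rfl)⟩

/-- The nonlinearity drops out of the `L²` balance by `tri_fst_self`. Young's inequality `2 q Φ ≤ γ
q² + Φ² / γ` spends half of the damping on the force; Grönwall with rate `γ` leaves `Φ² / γ²`, and
the `1` is slack. -/
theorem Orbit.eventually_l2 {γ : ℝ} (hγ : 0 < γ) {f : ℤ → ℂ} {Φ : ℝ} (hf : Force f Φ)
    {a : ℝ → ℤ → ℂ} (h : Orbit γ f a) :
    ∀ᶠ t in atTop, L2Le (fun k => ‖a t k‖) (Real.sqrt (Φ ^ 2 / γ / γ + 1)) := by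
  have hrate := (h.evol hf).hasRate_sq (j := 0) (by norm_num)
  have hev := hrate.eventually_le (c := γ) (C := Φ ^ 2 / γ) (t₀ := 1) hγ one_pos ?_ one_pos
  · filter_upwards [hev, eventually_ge_atTop 1] with t h1 h2
    obtain ⟨B, hB⟩ := h.h2Bound (one_pos.trans_le h2)
    refine (L2Le.of_summable hB.l2.summable).le_of_le (Real.sqrt_le_sqrt ?_)
    simpa using h1
  · intro t ht
    have ht0 : 0 < t := one_pos.trans_le ht
    obtain ⟨B, hB⟩ := h.h2Bound ht0
    have e := quadratic_rate (γ := γ) (κ := 1 / 2) (j := 0) (by norm_num) (h.herm t ht0)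
      (h.zero t ht0) hB hB hf.l2
    have e2 : tri (fun p => (p.1 : ℂ) ^ (2 * 0 + 1)) (a t) (a t) (a t) = 0 := by
      simpa using tri_fst_self (triLE_fst hB.l2₁ hB.l1 hB.l2)
    rw [e2] at e
    refine (le_of_eq e).trans ?_
    have hs : Summable fun k : ℤ => (|(k : ℝ)| ^ 0 * ‖a t k‖) ^ 2 := by
      simpa using hB.l2.summable
    have hl2 := L2Le.of_summable hs
    have hfb := norm_weighted_pairing_le (j := 0) hl2 (by simpa using hf.l2)
    have hre := (le_abs_self _).trans ((Complex.abs_re_le_norm _).trans hfb)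
    have hE : Real.sqrt (∑' k : ℤ, (|(k : ℝ)| ^ 0 * ‖a t k‖) ^ 2) ^ 2 = _ :=
      Real.sq_sqrt (tsum_nonneg fun k => sq_nonneg _)
    set q := Real.sqrt (∑' k : ℤ, (|(k : ℝ)| ^ 0 * ‖a t k‖) ^ 2) with hq
    rw [← hE]
    have h3 : 2 * (q * Φ) ≤ γ * q ^ 2 + Φ ^ 2 / γ := by
      have : γ * q ^ 2 + Φ ^ 2 / γ - 2 * (q * Φ) = (γ * q - Φ) ^ 2 / γ := by
        field_simp; ring
      have h4 : 0 ≤ (γ * q - Φ) ^ 2 / γ := by positivity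
      linarith
    simp only [mul_zero, Complex.zero_re, add_zero] at *
    nlinarith

/-- The rate of the cubic part of the energy. -/
theorem cubic_rate {γ : ℝ} {a f : ℤ → ℂ} {B Φ : ℝ} (hB : H2Bound a B)
    (hf : L2Le (fun k => ‖f k‖) Φ) (z : ℂ) :
    tri (fun _ => z) (kdvRem γ f a) a a + tri (fun _ => z) a (kdvRem γ f a) a
      + tri (fun _ => z) a a (kdvRem γ f a)
    = 3 * z * (-γ * tri (fun _ => 1) a a a + tri (fun _ => 1) a a f) := by
  have e1 := tri_rot (fun _ => z) a a (kdvRem γ f a)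
  have e2 := tri_rot (fun _ => z) a (kdvRem γ f a) a
  rw [e1, ← e2]
  have hg : L2Le (fun k : ℤ => ‖(k : ℂ) * conv a a k‖) (B * B + B * B) := by
    simpa only [norm_mul, Complex.norm_intCast] using hB.conv_self
  have t1 := triLE_const hB.l2 hB.l1 hB.l2 1
  have t2 := triLE_const hB.l2 hB.l1 hf 1
  have t3 := triLE_const hB.l2 hB.l1 hg 1
  have e3 := tri_self_conv t3
  have e4 : tri (fun _ => z) a a (kdvRem γ f a) = z * (-γ * tri (fun _ => 1) a a a
      + tri (fun _ => 1) a a f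
      - I * (1 / 2 : ℝ) * tri (fun _ => 1) a a (fun k => (k : ℂ) * conv a a k)) := by
    unfold tri
    rw [← tsum_mul_left, ← tsum_mul_left, ← (t1.summable.mul_left _).tsum_add t2.summable,
      ← ((t1.summable.mul_left _).add t2.summable).tsum_sub (t3.summable.mul_left _),
      ← tsum_mul_left]
    refine tsum_congr fun p => ?_
    simp only [kdvRem]
    ring
  rw [e4, e3]
  ring

/-- This is the Hamiltonian `∫ (u_x² - u³/3)`. By `tri_cube_self` the Airy derivative of the cubic
part is three times the form with symbol `k₁³`, so the coefficient `-1/3` cancels the cubic term in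
the rate of the quadratic part. The quartic term vanishes by `tri_self_conv`; only damping and
forcing survive. -/
theorem Orbit.hasRate_energy {γ : ℝ} {f : ℤ → ℂ} {Φ : ℝ} (hf : Force f Φ)
    {a : ℝ → ℤ → ℂ} (h : Orbit γ f a) :
    HasRate (fun t => ∑' k : ℤ, (|(k : ℝ)| ^ 1 * ‖a t k‖) ^ 2
        + (tri (fun _ => -1 / 3) (a t) (a t) (a t)).re)
      (fun t => -2 * γ * ∑' k : ℤ, (|(k : ℝ)| ^ 1 * ‖a t k‖) ^ 2
        + 2 * (∑' k : ℤ, (k : ℂ) ^ (2 * 1) * ((starRingEnd ℂ) (a t k) * f k)).re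
        + (γ * tri (fun _ => 1) (a t) (a t) (a t) - tri (fun _ => 1) (a t) (a t) f).re) := by
  have ev := h.evol hf
  have hsq := ev.hasRate_sq (j := 1) le_rfl
  have hcube : ∀ {b : ℤ → ℂ} {B : ℝ}, H2Bound b B → TriLE (fun p => (p.1 : ℂ) ^ 3) b b b
      (B * B * B + B * B * B) := fun hB => triLE_cube hB.l2₂ hB.l1 hB.l1₁ hB.l2 hB.l2₁
  have htri := ev.hasRate_tri ev ev (fun _ => -1 / 3) ?_ ?_ ?_ ?_ ?_
  · refine (hsq.add htri.re).congr fun t ht => ?_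
    obtain ⟨B, hB⟩ := h.h2Bound ht
    have e := quadratic_rate (γ := γ) (κ := 1 / 2) (j := 1) le_rfl (h.herm t ht)
      (h.zero t ht) hB hB hf.l2
    have e' : ∑' k : ℤ, 2 * (k : ℝ) ^ (2 * 1) * ((starRingEnd ℂ) (a t k) *
        kdvRem γ f (a t) k).re = _ := e
    have c1 := tri_cube_self (hcube hB)
    rw [e', cubic_rate hB hf.l2, tri_const_mul, tri_const_mul, c1]
    simp only [Complex.add_re, Complex.sub_re]
    have : (I * (-1 / 3 * (3 * tri (fun p => (p.1 : ℂ) ^ 3) (a t) (a t) (a t)))).re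
        = -(I * tri (fun p => (p.1 : ℂ) ^ (2 * 1 + 1)) (a t) (a t) (a t)).re := by
      rw [← Complex.neg_re]; ring_nf
    rw [this]
    have e3 : (3 * (-1 / 3) * (-(γ : ℂ) * tri (fun _ => 1) (a t) (a t) (a t)
        + tri (fun _ => 1) (a t) (a t) f)).re
        = (γ * tri (fun _ => 1) (a t) (a t) (a t)).re - (tri (fun _ => 1) (a t) (a t) f).re := by
      rw [← Complex.sub_re]; ring_nf
    rw [e3]
    ring
  · intro t ht
    obtain ⟨B, hB⟩ := h.h2Bound ht
    exact ⟨_, triLE_const hB.l2 hB.l1 hB.l2 _⟩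
  · intro T
    obtain ⟨B, hB⟩ := ev.h2Bound T
    have h1 := fun t ht hT => hcube (hB t ht hT)
    exact ⟨_, fun t ht hT => ((((h1 t ht hT).add (h1 t ht hT).rot).add
      (h1 t ht hT).rot.rot).const_mul (-1 / 3)).const_mul I⟩
  · intro T
    obtain ⟨B, hB⟩ := ev.h2Bound T
    obtain ⟨R, hR⟩ := ev.bdd_rem T
    exact ⟨_, fun t ht hT => triLE_const (hR t ht hT) (hB t ht hT).l1 (hB t ht hT).l2 _⟩
  · intro T
    obtain ⟨B, hB⟩ := ev.h2Bound T
    obtain ⟨R, hR⟩ := ev.bdd_rem T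
    exact ⟨_, fun t ht hT =>
      (triLE_const (hR t ht hT) (hB t ht hT).l1 (hB t ht hT).l2 _).swap⟩
  · intro T
    obtain ⟨B, hB⟩ := ev.h2Bound T
    obtain ⟨R, hR⟩ := ev.bdd_rem T
    exact ⟨_, fun t ht hT => triLE_const (hB t ht hT).l2 (hB t ht hT).l1 (hR t ht hT) _⟩

/-- Solutions are eventually bounded in `H¹` by a constant depending on `γ` and the force. -/
theorem exists_absorbing_ball {γ : ℝ} (hγ : 0 < γ) {f : ℤ → ℂ} {Φ : ℝ} (hf : Force f Φ) :
    ∃ R, ∀ a, Orbit γ f a → ∀ᶠ t in atTop, L2Le (fun k : ℤ => |(k : ℝ)| * ‖a t k‖) R := by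
  set ρ := Real.sqrt (Φ ^ 2 / γ / γ + 1) with hρ
  have hρ0 : 0 ≤ ρ := Real.sqrt_nonneg _
  have hΦ := hf.l2₁.1
  have hc := embConst_nonneg
  set L := embConst * ρ ^ 2 with hL
  have hL0 : 0 ≤ L := by positivity
  -- `K` collects the coefficients of `q`, the `H¹` norm, in the rate: the force against `u_xx`, the
  -- damping of the cubic part, and the force against `u²`. The constant `C` below completes the
  -- square in `(K + γ L) q ≤ γ q² + C`.
  set K := 2 * Φ + γ * L + embConst * ρ * Φ with hK
  have hK0 : 0 ≤ K := by positivity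
  set C := (K + γ * L) ^ 2 / (4 * γ) with hC
  have hC0 : 0 ≤ C := by positivity
  -- Grönwall gives energy at most `C / γ + 1`. The cubic part is at most `L q / 3`, and `2 L q ≤ q²
  -- + L²` absorbs it into the quadratic part.
  refine ⟨Real.sqrt (2 * (C / γ + 1) + L ^ 2), fun a h => ?_⟩
  have hest : ∀ᶠ t in atTop, 0 < t ∧ ∃ q, 0 ≤ q ∧
      q ^ 2 = ∑' k : ℤ, (|(k : ℝ)| ^ 1 * ‖a t k‖) ^ 2 ∧
      L2Le (fun k : ℤ => |(k : ℝ)| ^ 1 * ‖a t k‖) q ∧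
      ‖tri (fun _ => 1) (a t) (a t) (a t)‖ ≤ L * q ∧
      ‖tri (fun _ => 1) (a t) (a t) f‖ ≤ embConst * ρ * Φ * q := by
    filter_upwards [h.eventually_l2 hγ hf, eventually_gt_atTop 0] with t h1 ht
    obtain ⟨B, hB⟩ := h.h2Bound ht
    have hs : Summable fun k : ℤ => (|(k : ℝ)| ^ 1 * ‖a t k‖) ^ 2 := by
      simpa using hB.l2₁.summable
    have hq := L2Le.of_summable hs
    refine ⟨ht, _, hq.1, Real.sq_sqrt (tsum_nonneg fun _ => sq_nonneg _), hq, ?_, ?_⟩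
    · have hl1 := L2Le.sumLE_of_weighted (x := fun k => ‖a t k‖) (by simpa using hq)
        (by simp [h.zero t ht])
      refine (triLE_const h1 hl1 h1 1).norm_le.trans (le_of_eq ?_)
      simp only [pow_one, norm_one, hL]
      ring
    · have hl1 := L2Le.sumLE_of_weighted (x := fun k => ‖a t k‖) (by simpa using hq)
        (by simp [h.zero t ht])
      refine (triLE_const h1 hl1 hf.l2 1).norm_le.trans (le_of_eq ?_)
      simp only [pow_one, norm_one]
      ring
  have htri : ∀ t, (tri (fun _ => -1 / 3) (a t) (a t) (a t)).re
      = -(1 / 3) * (tri (fun _ => 1) (a t) (a t) (a t)).re := fun t => by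
    have := tri_const_mul (-1 / 3) (fun _ => 1) (a t) (a t) (a t)
    simp only [mul_one] at this
    rw [this, show (-1 / 3 : ℂ) = ((-(1 / 3) : ℝ) : ℂ) by push_cast; ring, Complex.re_ofReal_mul]
  obtain ⟨t₀, ht₀⟩ := eventually_atTop.1 hest
  have hev := (h.hasRate_energy hf).eventually_le (c := γ) (C := C) (t₀ := max t₀ 1) hγ
    (by positivity) ?_ one_pos
  · filter_upwards [hev, hest] with t h1 ⟨ht, q, hq0, hq, hl, hT, _⟩
    have hl' : L2Le (fun k : ℤ => |(k : ℝ)| * ‖a t k‖) q := by simpa using hl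
    refine hl'.le_of_le (Real.le_sqrt_of_sq_le ?_)
    rw [htri, ← hq] at h1
    have h2 := (abs_le.1 ((Complex.abs_re_le_norm _).trans hT)).2
    have h3 := mul_nonneg hL0 hq0
    nlinarith [sq_nonneg (q - L)]
  · intro t ht
    obtain ⟨ht, q, hq0, hq, hl, hT, hTf⟩ := ht₀ t ((le_max_left _ _).trans ht)
    rw [htri, ← hq]
    have h1 := abs_le.1 ((Complex.abs_re_le_norm _).trans hT)
    have h2 := abs_le.1 ((Complex.abs_re_le_norm _).trans hTf)
    have h3 := (le_abs_self _).trans ((Complex.abs_re_le_norm _).trans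
      (norm_weighted_pairing_le hl (by simpa using hf.l2₁)))
    rw [Complex.sub_re, Complex.re_ofReal_mul]
    have h4 : (K + γ * L) * q ≤ γ * q ^ 2 + C := by
      have : γ * q ^ 2 + C - (K + γ * L) * q = (2 * γ * q - (K + γ * L)) ^ 2 / (4 * γ) := by
        rw [hC]; field_simp; ring
      have h5 : 0 ≤ (2 * γ * q - (K + γ * L)) ^ 2 / (4 * γ) := by positivity
      linarith
    have h6 := mul_le_mul_of_nonneg_left h1.1 hγ.le
    have h7 := mul_le_mul_of_nonneg_left h1.2 hγ.le
    have h8 : 0 ≤ γ * (L * q) := by positivity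
    rw [hK] at h4
    linarith

/-! ### The difference of two solutions -/

/-- The symbol of the cubic correction `∫ (-W w² + (1/3) D²W (D⁻¹w)²)` of the energy of the
difference `w` of two solutions with mean `W`. -/
noncomputable def diffSym (p : ℤ × ℤ) : ℂ :=
  -1 + ((-p.1 - p.2 : ℤ) : ℂ) ^ 2 / (3 * p.1 * p.2)

/-- The homological equation of the normal form, from `k₁³ + k₂³ + k₃³ = 3 k₁ k₂ k₃`. Multiplied out
it holds also for `k₃ = 0`, so only the first two frequencies must be nonzero. -/
theorem diffSym_mul {p : ℤ × ℤ} (h1 : p.1 ≠ 0) (h2 : p.2 ≠ 0) :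
    diffSym p * ((p.1 : ℂ) ^ 3 + (p.2 : ℂ) ^ 3 + ((-p.1 - p.2 : ℤ) : ℂ) ^ 3)
      = -((p.1 : ℂ) ^ 3 + (p.2 : ℂ) ^ 3) := by
  have h1' : (p.1 : ℂ) ≠ 0 := by exact_mod_cast h1
  have h2' : (p.2 : ℂ) ≠ 0 := by exact_mod_cast h2
  rw [diffSym]
  push_cast
  field_simp
  ring

theorem diffSym_swap (p : ℤ × ℤ) : diffSym (p.2, p.1) = diffSym p := by
  simp only [diffSym]
  rw [show -p.2 - p.1 = -p.1 - p.2 by ring, mul_right_comm]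

theorem abs_third_le (p : ℤ × ℤ) : |((-p.1 - p.2 : ℤ) : ℝ)| ≤ |(p.1 : ℝ)| + |(p.2 : ℝ)| := by
  rw [show ((-p.1 - p.2 : ℤ) : ℝ) = -((p.1 : ℝ) + p.2) by push_cast; ring, abs_neg]
  exact abs_add_le _ _

theorem abs_fst_le (p : ℤ × ℤ) : |(p.1 : ℝ)| ≤ |(p.2 : ℝ)| + |((-p.1 - p.2 : ℤ) : ℝ)| := by
  rw [show (p.1 : ℝ) = -((p.2 : ℝ) + ((-p.1 - p.2 : ℤ) : ℝ)) by push_cast; ring, abs_neg]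
  exact abs_add_le _ _

/-- The ratio form shows that the symbol costs one derivative on one copy of the difference and
gains one on the other, so the correction has the size of a product of an `L²` and an `H¹` norm. -/
theorem norm_diffSym_le {p : ℤ × ℤ} (h1 : p.1 ≠ 0) (h2 : p.2 ≠ 0) :
    ‖diffSym p‖ ≤ 2 * (|(p.1 : ℝ)| / |(p.2 : ℝ)| + |(p.2 : ℝ)| / |(p.1 : ℝ)|) := by
  have h1' : 0 < |(p.1 : ℝ)| := by simpa using h1
  have h2' : 0 < |(p.2 : ℝ)| := by simpa using h2
  have h3 := abs_third_le p
  have h4 : ‖diffSym p‖ ≤ 1 + |((-p.1 - p.2 : ℤ) : ℝ)| ^ 2 / (3 * |(p.1 : ℝ)| * |(p.2 : ℝ)|) := by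
    refine (norm_add_le _ _).trans (le_of_eq ?_)
    rw [norm_neg, norm_one, norm_div, norm_pow, norm_mul, norm_mul]
    simp only [Complex.norm_intCast]
    norm_num
  refine h4.trans ?_
  set x := |(p.1 : ℝ)|
  set y := |(p.2 : ℝ)|
  set z := |((-p.1 - p.2 : ℤ) : ℝ)|
  have hz : z ^ 2 ≤ (x + y) ^ 2 := pow_le_pow_left₀ (abs_nonneg _) h3 2
  have e : 2 * (x / y + y / x) - (1 + z ^ 2 / (3 * x * y))
      = (6 * (x ^ 2 + y ^ 2) - 3 * x * y - z ^ 2) / (3 * x * y) := by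
    field_simp
    ring
  have : 0 ≤ (6 * (x ^ 2 + y ^ 2) - 3 * x * y - z ^ 2) / (3 * x * y) := by
    refine div_nonneg ?_ (by positivity)
    nlinarith [sq_nonneg (x - y)]
  linarith

/-- At zero frequency the division in `diffSym` takes its default value and the estimates on the
symbol fail. Mean-free factors remove these terms. -/
theorem TriLE.of_le_ne_zero {m : ℤ × ℤ → ℂ} {a b c : ℤ → ℂ} {φ : ℤ × ℤ → ℝ} {B : ℝ}
    (h : SumLE φ B) (hφ : ∀ p, 0 ≤ φ p) (ha : a 0 = 0) (hb : b 0 = 0)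
    (hle : ∀ p : ℤ × ℤ, p.1 ≠ 0 → p.2 ≠ 0 →
      ‖m p‖ * (‖a p.1‖ * ‖b p.2‖ * ‖c (-p.1 - p.2)‖) ≤ φ p) : TriLE m a b c B := by
  refine h.mono fun p => ?_
  by_cases h1 : p.1 = 0
  · simpa [h1, ha] using hφ p
  by_cases h2 : p.2 = 0
  · simpa [h2, hb] using hφ p
  exact hle p h1 h2

theorem L2Le.sumLE_div_abs {a : ℤ → ℂ} {A : ℝ} (h : L2Le (fun k => ‖a k‖) A) :
    SumLE (fun k : ℤ => ‖a k‖ / |(k : ℝ)|) (embConst * A) := by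
  refine (l2Le_inv_abs.sum_mul_le h).mono fun k => le_of_eq (by ring)

/-- One copy of `w` carries `|k|` and stays in `ℓ²`; the other carries `1 / |k|` and lands in `ℓ¹`.
Hence `c` is needed only in `ℓ²`, which suits the remainder of the mean. -/
theorem triLE_diffSym₃ {w c : ℤ → ℂ} {P Q Z : ℝ} (h0 : w 0 = 0)
    (hP : L2Le (fun k => ‖w k‖) P) (hQ : L2Le (fun k : ℤ => |(k : ℝ)| * ‖w k‖) Q)
    (hZ : L2Le (fun k => ‖c k‖) Z) :
    TriLE diffSym w w c (4 * (Q * (embConst * P) * Z)) := by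
  have h1 := sumLE_tri hQ hP.sumLE_div_abs hZ (fun _ => by positivity) (fun _ => by positivity)
    (fun _ => by positivity)
  have h2 := h1.swap
  refine SumLE.le_of_le (TriLE.of_le_ne_zero ((h1.add h2).const_mul (c := 2) (by norm_num))
    (fun p => by positivity) h0 h0 fun p p1 p2 => ?_) (by linarith)
  refine (mul_le_mul_of_nonneg_right (norm_diffSym_le p1 p2) (by positivity)).trans (le_of_eq ?_)
  simp only [show -p.2 - p.1 = -p.1 - p.2 by ring]
  ring

/-- The factor `r` is a nonlinear remainder, only in `ℓ²`, and cannot carry the `|k₁|` of the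
symbol. Using `|k₁| ≤ |k₂| + |k₃|` moves that derivative away, and the opposite ratio uses the
better bound on `r / |k|`. -/
theorem triLE_diffSym₁ {r w c : ℤ → ℂ} {A A' P Q R C : ℝ} (hr0 : r 0 = 0) (h0 : w 0 = 0)
    (hA : L2Le (fun k => ‖r k‖) A) (hA' : L2Le (fun k : ℤ => ‖r k‖ / |(k : ℝ)|) A')
    (hP : L2Le (fun k => ‖w k‖) P) (hQ : L2Le (fun k : ℤ => |(k : ℝ)| * ‖w k‖) Q)
    (hR : L2Le (fun k : ℤ => |(k : ℝ)| * ‖c k‖) R) (hC : SumLE (fun k => ‖c k‖) C) :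
    TriLE diffSym r w c (2 * (A * P * C + A * (embConst * P) * R + A' * Q * C)) := by
  have h1 := sumLE_tri₃ hA hP hC (fun _ => by positivity) (fun _ => by positivity)
    (fun _ => by positivity)
  have h2 := sumLE_tri hA hP.sumLE_div_abs hR (fun _ => by positivity) (fun _ => by positivity)
    (fun _ => by positivity)
  have h3 := sumLE_tri₃ hA' hQ hC (fun _ => by positivity) (fun _ => by positivity)
    (fun _ => by positivity)
  refine TriLE.of_le_ne_zero (((h1.add h2).add h3).const_mul (c := 2) (by norm_num))
    (fun p => by positivity) hr0 h0 fun p p1 p2 => ?_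
  have hp2 : 0 < |(p.2 : ℝ)| := by simpa using p2
  have h4 : |(p.1 : ℝ)| / |(p.2 : ℝ)| ≤ 1 + |((-p.1 - p.2 : ℤ) : ℝ)| / |(p.2 : ℝ)| := by
    rw [div_le_iff₀ hp2, add_mul, div_mul_cancel₀ _ hp2.ne', one_mul]
    exact abs_fst_le p
  have h5 : ‖diffSym p‖ ≤ 2 * (1 + |((-p.1 - p.2 : ℤ) : ℝ)| / |(p.2 : ℝ)|
      + |(p.2 : ℝ)| / |(p.1 : ℝ)|) := by
    refine (norm_diffSym_le p1 p2).trans ?_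
    gcongr
  refine (mul_le_mul_of_nonneg_right h5 (by positivity)).trans (le_of_eq ?_)
  ring

/-! ### Difference and mean of two solutions: bounds and cancellation -/

/-- The difference of two sequences. -/
noncomputable def dif (a b : ℤ → ℂ) (k : ℤ) : ℂ := (1 : ℝ) * a k + (-1 : ℝ) * b k

/-- The mean of two sequences. -/
noncomputable def avg (a b : ℤ → ℂ) (k : ℤ) : ℂ := (1 / 2 : ℝ) * a k + (1 / 2 : ℝ) * b k

theorem norm_avg_le (a b : ℤ → ℂ) (k : ℤ) : ‖avg a b k‖ ≤ 1 / 2 * ‖a k‖ + 1 / 2 * ‖b k‖ := by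
  refine (norm_add_le _ _).trans (le_of_eq ?_)
  simp

theorem norm_dif_le (a b : ℤ → ℂ) (k : ℤ) : ‖dif a b k‖ ≤ ‖a k‖ + ‖b k‖ := by
  refine (norm_add_le _ _).trans (le_of_eq ?_)
  simp

theorem l2Le_avg {a b : ℤ → ℂ} {A : ℝ} (ha : L2Le (fun k => ‖a k‖) A)
    (hb : L2Le (fun k => ‖b k‖) A) : L2Le (fun k => ‖avg a b k‖) A := by
  refine (((ha.const_mul (c := 1 / 2) (by norm_num)).add (hb.const_mul (c := 1 / 2)
    (by norm_num))).mono (fun _ => norm_nonneg _) (norm_avg_le a b)).le_of_le (by linarith)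

theorem l2Le_abs_mul_avg {a b : ℤ → ℂ} {A : ℝ} (ha : L2Le (fun k : ℤ => |(k : ℝ)| * ‖a k‖) A)
    (hb : L2Le (fun k : ℤ => |(k : ℝ)| * ‖b k‖) A) :
    L2Le (fun k : ℤ => |(k : ℝ)| * ‖avg a b k‖) A := by
  refine (((ha.const_mul (c := 1 / 2) (by norm_num)).add (hb.const_mul (c := 1 / 2)
    (by norm_num))).mono (fun _ => by positivity) fun k => ?_).le_of_le (by linarith)
  refine (mul_le_mul_of_nonneg_left (norm_avg_le a b k) (abs_nonneg _)).trans (le_of_eq ?_)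
  ring

/-- The factorisation `(a - b)(a + b)/2 = (a² - b²)/2`; the mixed terms cancel because convolution
is commutative. -/
theorem conv_dif_avg {a b : ℤ → ℂ} {A B : ℝ} (ha : L2Le (fun k => ‖a k‖) A)
    (hb : L2Le (fun k => ‖b k‖) B) (k : ℤ) :
    conv (dif a b) (avg a b) k = (1 / 2 : ℝ) * (conv a a k - conv b b k) := by
  have haa := summable_conv ha ha k
  have hbb := summable_conv hb hb k
  have hab := summable_conv ha hb k
  have hba := summable_conv hb ha k
  have hcomm : ∑' j : ℤ, b j * a (k - j) = ∑' j : ℤ, a j * b (k - j) := by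
    rw [← (Equiv.subLeft k).tsum_eq]
    refine tsum_congr fun j => ?_
    simp only [Equiv.subLeft_apply, sub_sub_cancel]
    ring
  calc conv (dif a b) (avg a b) k
      = ∑' j : ℤ, (1 / 2 : ℝ) * ((a j * a (k - j) - b j * b (k - j))
        + (a j * b (k - j) - b j * a (k - j))) := by
        refine tsum_congr fun j => ?_
        simp only [dif, avg]
        push_cast
        ring
    _ = _ := by
        rw [tsum_mul_left, (haa.sub hbb).tsum_add (hab.sub hba), haa.tsum_sub hbb,
          hab.tsum_sub hba, hcomm, sub_self, add_zero]
        rfl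

theorem dif_kdvRem {γ : ℝ} {f a b : ℤ → ℂ} {A B : ℝ} (ha : L2Le (fun k => ‖a k‖) A)
    (hb : L2Le (fun k => ‖b k‖) B) (k : ℤ) :
    dif (kdvRem γ f a) (kdvRem γ f b) k
      = -γ * dif a b k + 0 - I * (1 : ℝ) * k * conv (dif a b) (avg a b) k := by
  rw [conv_dif_avg ha hb]
  simp only [dif, kdvRem]
  push_cast
  ring

/-- Quantities controlling the difference and the mean of two solutions at a fixed time. -/
structure PairBound (γ Φ R : ℝ) (f a b : ℤ → ℂ) (P Q : ℝ) : Prop where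
  force : Force f Φ
  zero_fst : a 0 = 0
  zero_snd : b 0 = 0
  fst : L2Le (fun k : ℤ => |(k : ℝ)| * ‖a k‖) R
  snd : L2Le (fun k : ℤ => |(k : ℝ)| * ‖b k‖) R
  dif_l2 : L2Le (fun k => ‖dif a b k‖) P
  dif_l2₁ : L2Le (fun k : ℤ => |(k : ℝ)| * ‖dif a b k‖) Q

namespace PairBound

variable {γ Φ R P Q : ℝ} {f a b : ℤ → ℂ}

theorem fst_l2 (h : PairBound γ Φ R f a b P Q) : L2Le (fun k => ‖a k‖) R :=
  h.fst.of_weighted (fun _ => norm_nonneg _) (by simp [h.zero_fst])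

theorem snd_l2 (h : PairBound γ Φ R f a b P Q) : L2Le (fun k => ‖b k‖) R :=
  h.snd.of_weighted (fun _ => norm_nonneg _) (by simp [h.zero_snd])

theorem dif_zero (h : PairBound γ Φ R f a b P Q) : dif a b 0 = 0 := by
  simp [dif, h.zero_fst, h.zero_snd]

theorem dif_kdvRem_zero (h : PairBound γ Φ R f a b P Q) :
    dif (kdvRem γ f a) (kdvRem γ f b) 0 = 0 := by
  simp [dif, kdvRem, h.zero_fst, h.zero_snd, h.force.zero]

theorem avg_l2₁ (h : PairBound γ Φ R f a b P Q) :
    L2Le (fun k : ℤ => |(k : ℝ)| * ‖avg a b k‖) R := l2Le_abs_mul_avg h.fst h.snd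

theorem avg_l1 (h : PairBound γ Φ R f a b P Q) :
    SumLE (fun k => ‖avg a b k‖) (embConst * R) :=
  h.avg_l2₁.sumLE_of_weighted (by simp [avg, h.zero_fst, h.zero_snd])

theorem dif_l1 (h : PairBound γ Φ R f a b P Q) :
    SumLE (fun k => ‖dif a b k‖) (embConst * Q) :=
  h.dif_l2₁.sumLE_of_weighted (by simp [h.dif_zero])

theorem norm_dif_kdvRem_le (h : PairBound γ Φ R f a b P Q) (k : ℤ) :
    ‖dif (kdvRem γ f a) (kdvRem γ f b) k‖
      ≤ |γ| * ‖dif a b k‖ + |(k : ℝ)| * ‖conv (dif a b) (avg a b) k‖ := by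
  rw [dif_kdvRem h.fst_l2 h.snd_l2]
  refine (norm_sub_le _ _).trans (le_of_eq ?_)
  simp

theorem l2Le_dif_kdvRem (h : PairBound γ Φ R f a b P Q) :
    L2Le (fun k => ‖dif (kdvRem γ f a) (kdvRem γ f b) k‖)
      (|γ| * Q + 2 * (embConst * R * Q)) := by
  have hl2 : L2Le (fun k => ‖dif a b k‖) Q :=
    h.dif_l2₁.of_weighted (fun _ => norm_nonneg _) (by simp [h.dif_zero])
  have hc := l2Le_abs_mul_conv hl2 h.avg_l1 h.dif_l1 h.dif_l2₁ h.avg_l2₁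
  refine (((hl2.const_mul (abs_nonneg γ)).add hc).mono (fun _ => norm_nonneg _)
    h.norm_dif_kdvRem_le).le_of_le (le_of_eq ?_)
  ring

/-- Dividing by `|k|` undoes the derivative in the nonlinearity, so the bound involves the `L²` size
`P` instead of the `H¹` size `Q`. This is what makes every remainder proportional to `P * Q`. -/
theorem l2Le_dif_kdvRem_div (h : PairBound γ Φ R f a b P Q) :
    L2Le (fun k : ℤ => ‖dif (kdvRem γ f a) (kdvRem γ f b) k‖ / |(k : ℝ)|)
      (|γ| * P + P * (embConst * R)) := by
  have hc := l2Le_conv h.dif_l2 h.avg_l1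
  refine ((h.dif_l2.const_mul (abs_nonneg γ)).add hc).mono (fun _ => by positivity) fun k => ?_
  by_cases hk : k = 0
  · subst hk
    simp only [Int.cast_zero, abs_zero, div_zero]
    positivity
  · have hk' := one_le_abs_intCast hk
    rw [div_le_iff₀ (by linarith)]
    refine (h.norm_dif_kdvRem_le k).trans ?_
    have h1 : |γ| * ‖dif a b k‖ ≤ |γ| * ‖dif a b k‖ * |(k : ℝ)| :=
      le_mul_of_one_le_right (by positivity) hk'
    linarith

theorem l2Le_avg_kdvRem (h : PairBound γ Φ R f a b P Q) :
    L2Le (fun k => ‖avg (kdvRem γ f a) (kdvRem γ f b) k‖)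
      (|γ| * R + Φ + 2 * (embConst * R * R)) := by
  have key : ∀ {c : ℤ → ℂ}, c 0 = 0 → L2Le (fun k : ℤ => |(k : ℝ)| * ‖c k‖) R →
      L2Le (fun k => ‖kdvRem γ f c k‖) (|γ| * R + Φ + 2 * (embConst * R * R)) := by
    intro c h0 hc
    have hl2 : L2Le (fun k => ‖c k‖) R :=
      hc.of_weighted (fun _ => norm_nonneg _) (by simp [h0])
    have hl1 : SumLE (fun k => ‖c k‖) (embConst * R) := hc.sumLE_of_weighted (by simp [h0])
    refine ((((hl2.const_mul (abs_nonneg γ)).add h.force.l2).add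
      (l2Le_abs_mul_conv hl2 hl1 hl1 hc hc)).mono (fun _ => norm_nonneg _)
      (norm_kdvRem_le γ f c)).le_of_le (le_of_eq ?_)
    ring
  exact l2Le_avg (key h.zero_fst h.fst) (key h.zero_snd h.snd)

theorem triLE_energy (h : PairBound γ Φ R f a b P Q) :
    TriLE diffSym (dif a b) (dif a b) (avg a b) (4 * (Q * (embConst * P) * R)) :=
  triLE_diffSym₃ h.dif_zero h.dif_l2 h.dif_l2₁ (l2Le_avg h.fst_l2 h.snd_l2)

theorem triLE_rem₁ (h : PairBound γ Φ R f a b P Q) :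
    TriLE diffSym (dif (kdvRem γ f a) (kdvRem γ f b)) (dif a b) (avg a b)
      (2 * (embConst * R * (2 * (|γ| + 2 * (embConst * R)) + (|γ| + embConst * R)))
        * (P * Q)) :=
  (triLE_diffSym₁ h.dif_kdvRem_zero h.dif_zero h.l2Le_dif_kdvRem h.l2Le_dif_kdvRem_div h.dif_l2
    h.dif_l2₁ h.avg_l2₁ h.avg_l1).le_of_le (le_of_eq (by ring))

theorem triLE_rem₂ (h : PairBound γ Φ R f a b P Q) :
    TriLE diffSym (dif a b) (dif (kdvRem γ f a) (kdvRem γ f b)) (avg a b)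
      (2 * (embConst * R * (2 * (|γ| + 2 * (embConst * R)) + (|γ| + embConst * R)))
        * (P * Q)) := by
  have := h.triLE_rem₁.swap
  simpa only [diffSym_swap] using this

theorem triLE_rem₃ (h : PairBound γ Φ R f a b P Q) :
    TriLE diffSym (dif a b) (dif a b) (avg (kdvRem γ f a) (kdvRem γ f b))
      (4 * (Q * (embConst * P) * (|γ| * R + Φ + 2 * (embConst * R * R)))) :=
  triLE_diffSym₃ h.dif_zero h.dif_l2 h.dif_l2₁ h.l2Le_avg_kdvRem

theorem triLE_cube_fst (h : PairBound γ Φ R f a b P Q) {B : ℝ} (hB : H2Bound (dif a b) B) :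
    TriLE (fun p => (p.1 : ℂ) ^ 3) (dif a b) (dif a b) (avg a b) (B * B * R + B * B * R) :=
  triLE_cube hB.l2₂ hB.l1 hB.l1₁ (l2Le_avg h.fst_l2 h.snd_l2) h.avg_l2₁

theorem triLE_dispersive (h : PairBound γ Φ R f a b P Q) {B : ℝ} (hB : H2Bound (dif a b) B) :
    TriLE (fun p => I * (diffSym p * ((p.1 : ℂ) ^ 3 + (p.2 : ℂ) ^ 3
      + ((-p.1 - p.2 : ℤ) : ℂ) ^ 3))) (dif a b) (dif a b) (avg a b)
      ((B * B * R + B * B * R) + (B * B * R + B * B * R)) := by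
  have h1 := h.triLE_cube_fst hB
  refine TriLE.of_le_ne_zero (h1.add h1.swap) (fun p => mul_nonneg (norm_nonneg _)
    (mul_nonneg (mul_nonneg (norm_nonneg _) (norm_nonneg _)) (norm_nonneg _))) h.dif_zero h.dif_zero
    fun p p1 p2 => ?_
  rw [diffSym_mul p1 p2, norm_mul, Complex.norm_I, one_mul, norm_neg]

/-- Away from zero modes the symbol is `-I (k₁³ + k₂³)` by `diffSym_mul`, and exchanging the two
copies of the difference identifies the two summands. -/
theorem tri_dispersive (h : PairBound γ Φ R f a b P Q) {B : ℝ} (hB : H2Bound (dif a b) B) :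
    tri (fun p => I * (diffSym p * ((p.1 : ℂ) ^ 3 + (p.2 : ℂ) ^ 3
      + ((-p.1 - p.2 : ℤ) : ℂ) ^ 3))) (dif a b) (dif a b) (avg a b)
    = -(2 * (I * tri (fun p => (p.1 : ℂ) ^ 3) (dif a b) (dif a b) (avg a b))) := by
  have h1 := h.triLE_cube_fst hB
  have e1 := h1.tri_add h1.swap
  have e2 := tri_swap (fun p => (p.1 : ℂ) ^ 3) (dif a b) (dif a b) (avg a b)
  rw [e2] at e1
  have e3 : tri (fun p => I * (diffSym p * ((p.1 : ℂ) ^ 3 + (p.2 : ℂ) ^ 3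
      + ((-p.1 - p.2 : ℤ) : ℂ) ^ 3))) (dif a b) (dif a b) (avg a b)
      = tri (fun p => -I * ((p.1 : ℂ) ^ 3 + (p.2 : ℂ) ^ 3)) (dif a b) (dif a b) (avg a b) := by
    refine tsum_congr fun p => ?_
    by_cases p1 : p.1 = 0
    · simp [p1, h.dif_zero]
    by_cases p2 : p.2 = 0
    · simp [p2, h.dif_zero]
    beta_reduce
    rw [diffSym_mul p1 p2]
    ring
  rw [e3, tri_const_mul, e1]
  ring

/-- The nonlinear and lower order contributions are small when `P` is small. -/
theorem rate_le (h : PairBound γ Φ R f a b P Q) :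
    ‖tri diffSym (dif (kdvRem γ f a) (kdvRem γ f b)) (dif a b) (avg a b)
      + tri diffSym (dif a b) (dif (kdvRem γ f a) (kdvRem γ f b)) (avg a b)
      + tri diffSym (dif a b) (dif a b) (avg (kdvRem γ f a) (kdvRem γ f b))‖
    ≤ embConst * (4 * (2 * ((|γ| + 2 * (embConst * R)) * R) + (|γ| + embConst * R) * R)
      + 4 * (|γ| * R + Φ + 2 * (embConst * R * R))) * (P * Q) := by
  refine norm_add₃_le.trans ((add_le_add (add_le_add h.triLE_rem₁.norm_le h.triLE_rem₂.norm_le)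
    h.triLE_rem₃.norm_le).trans (le_of_eq ?_))
  ring

end PairBound

theorem Orbit.evol_dif {γ Φ : ℝ} {f : ℤ → ℂ} (hf : Force f Φ) {a b : ℝ → ℤ → ℂ}
    (ha : Orbit γ f a) (hb : Orbit γ f b) :
    Evol (fun t => dif (a t) (b t)) (fun t => dif (kdvRem γ f (a t)) (kdvRem γ f (b t))) :=
  (ha.evol hf).lincomb (hb.evol hf) 1 (-1)

theorem Orbit.evol_avg {γ Φ : ℝ} {f : ℤ → ℂ} (hf : Force f Φ) {a b : ℝ → ℤ → ℂ}
    (ha : Orbit γ f a) (hb : Orbit γ f b) :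
    Evol (fun t => avg (a t) (b t)) (fun t => avg (kdvRem γ f (a t)) (kdvRem γ f (b t))) :=
  (ha.evol hf).lincomb (hb.evol hf) (1 / 2) (1 / 2)

theorem Orbit.pairBound {γ Φ : ℝ} {f : ℤ → ℂ} (hf : Force f Φ) {a b : ℝ → ℤ → ℂ}
    (ha : Orbit γ f a) (hb : Orbit γ f b) (T : ℝ) : ∃ R, ∀ t, 0 < t → t ≤ T →
      PairBound γ Φ R f (a t) (b t) R R ∧ H2Bound (dif (a t) (b t)) R
        ∧ H2Bound (avg (a t) (b t)) R := by
  obtain ⟨A, hA⟩ := (ha.evol hf).h2Bound T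
  obtain ⟨B, hB⟩ := (hb.evol hf).h2Bound T
  obtain ⟨D, hD⟩ := (ha.evol_dif hf hb).h2Bound T
  obtain ⟨E, hE⟩ := (ha.evol_avg hf hb).h2Bound T
  refine ⟨max (max A B) (max D E), fun t ht hT => ?_⟩
  have hAR : A ≤ max (max A B) (max D E) := (le_max_left _ _).trans (le_max_left _ _)
  have hBR : B ≤ max (max A B) (max D E) := (le_max_right _ _).trans (le_max_left _ _)
  have hDR : D ≤ max (max A B) (max D E) := (le_max_left _ _).trans (le_max_right _ _)
  have hER : E ≤ max (max A B) (max D E) := (le_max_right _ _).trans (le_max_right _ _)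
  have h1 := hA t ht hT
  have h2 := hB t ht hT
  have h3 := hD t ht hT
  have h4 := hE t ht hT
  exact ⟨⟨hf, ha.zero t ht, hb.zero t ht, h1.l2₁.le_of_le hAR, h2.l2₁.le_of_le hBR,
      h3.l2.le_of_le hDR, h3.l2₁.le_of_le hDR⟩,
    ⟨h3.l2₂.le_of_le hDR, h3.l2₁.le_of_le hDR, h3.l2.le_of_le hDR, h3.l1₁.le_of_le hDR,
      h3.l1.le_of_le hDR⟩,
    ⟨h4.l2₂.le_of_le hER, h4.l2₁.le_of_le hER, h4.l2.le_of_le hER, h4.l1₁.le_of_le hER,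
      h4.l1.le_of_le hER⟩⟩

/-- The nonlinear term in the rate of the `H¹` norm (`quadratic_rate` with `κ = 1`) is exactly
opposite to the dispersive rate of the correction (`tri_dispersive`). What remains beside the
damping is the correction evaluated on the remainders. -/
theorem Orbit.hasRate_difference {γ Φ : ℝ} {f : ℤ → ℂ} (hf : Force f Φ) {a b : ℝ → ℤ → ℂ}
    (ha : Orbit γ f a) (hb : Orbit γ f b) :
    HasRate (fun t => ∑' k : ℤ, (|(k : ℝ)| ^ 1 * ‖dif (a t) (b t) k‖) ^ 2
        + (tri diffSym (dif (a t) (b t)) (dif (a t) (b t)) (avg (a t) (b t))).re)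
      (fun t => -2 * γ * ∑' k : ℤ, (|(k : ℝ)| ^ 1 * ‖dif (a t) (b t) k‖) ^ 2
        + (tri diffSym (dif (kdvRem γ f (a t)) (kdvRem γ f (b t))) (dif (a t) (b t))
            (avg (a t) (b t))
          + tri diffSym (dif (a t) (b t)) (dif (kdvRem γ f (a t)) (kdvRem γ f (b t)))
            (avg (a t) (b t))
          + tri diffSym (dif (a t) (b t)) (dif (a t) (b t))
            (avg (kdvRem γ f (a t)) (kdvRem γ f (b t)))).re) := by
  have ed := ha.evol_dif hf hb
  have ea := ha.evol_avg hf hb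
  have hpb := ha.pairBound hf hb
  have hsq := ed.hasRate_sq (j := 1) le_rfl
  have htri := ed.hasRate_tri ed ea diffSym ?_ ?_ ?_ ?_ ?_
  · refine (hsq.add htri.re).congr fun t ht => ?_
    obtain ⟨R, hR⟩ := hpb t
    obtain ⟨h1, h2, h3⟩ := hR t ht le_rfl
    have e := quadratic_rate (γ := γ) (κ := 1) (j := 1) (f := fun _ => 0) (Φ := 0) le_rfl
      (ed.herm t ht) (ed.zero t ht) h2 h3 ⟨le_rfl, fun s => by simp⟩
    have e1 : ∑' k : ℤ, 2 * (k : ℝ) ^ (2 * 1) * ((starRingEnd ℂ) (dif (a t) (b t) k) *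
        dif (kdvRem γ f (a t)) (kdvRem γ f (b t)) k).re = _ :=
      (tsum_congr fun k => by rw [dif_kdvRem h1.fst_l2 h1.snd_l2]).trans e
    rw [e1, h1.tri_dispersive h2, Complex.add_re (-_), Complex.neg_re]
    have e2 : ((2 : ℂ) * (I * tri (fun p => (p.1 : ℂ) ^ 3) (dif (a t) (b t)) (dif (a t) (b t))
        (avg (a t) (b t)))).re = 2 * (I * tri (fun p => (p.1 : ℂ) ^ (2 * 1 + 1))
        (dif (a t) (b t)) (dif (a t) (b t)) (avg (a t) (b t))).re := by
      rw [show (2 : ℂ) = ((2 : ℝ) : ℂ) by push_cast; rfl, Complex.re_ofReal_mul]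
    rw [e2]
    simp only [mul_zero, tsum_zero, Complex.zero_re]
    ring
  · intro t ht
    obtain ⟨R, hR⟩ := hpb t
    exact ⟨_, (hR t ht le_rfl).1.triLE_energy⟩
  · intro T
    obtain ⟨R, hR⟩ := hpb T
    exact ⟨_, fun t ht hT => (hR t ht hT).1.triLE_dispersive (hR t ht hT).2.1⟩
  · intro T
    obtain ⟨R, hR⟩ := hpb T
    exact ⟨_, fun t ht hT => (hR t ht hT).1.triLE_rem₁⟩
  · intro T
    obtain ⟨R, hR⟩ := hpb T
    exact ⟨_, fun t ht hT => (hR t ht hT).1.triLE_rem₂⟩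
  · intro T
    obtain ⟨R, hR⟩ := hpb T
    exact ⟨_, fun t ht hT => (hR t ht hT).1.triLE_rem₃⟩

/-! ### Determining modes -/

/-- Splitting into low and high modes. -/
theorem l2Le_of_low_modes {w : ℤ → ℂ} {N : ℕ} (hN : 0 < N) {δ q : ℝ} (hδ : 0 ≤ δ)
    (hlow : ∀ k : ℤ, |k| ≤ N → ‖w k‖ ≤ δ) (hq : L2Le (fun k : ℤ => |(k : ℝ)| * ‖w k‖) q) :
    L2Le (fun k => ‖w k‖) ((2 * N + 1) * δ + q / N) := by
  classical
  have hN' : (0 : ℝ) < N := by exact_mod_cast hN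
  have h1 : L2Le (fun k : ℤ => if |k| ≤ N then δ else 0) ((2 * N + 1) * δ) := by
    refine ⟨by positivity, fun s => ?_⟩
    have : ∑ k ∈ s, (if |k| ≤ (N : ℤ) then δ else 0) ^ 2
        ≤ ∑ k ∈ Finset.Icc (-(N : ℤ)) N, δ ^ 2 := by
      calc _ = ∑ k ∈ s, if k ∈ Finset.Icc (-(N : ℤ)) N then δ ^ 2 else 0 := by
            refine Finset.sum_congr rfl fun k _ => ?_
            simp only [Finset.mem_Icc, ← abs_le]
            split_ifs <;> simp
        _ = ∑ k ∈ s ∩ Finset.Icc (-(N : ℤ)) N, δ ^ 2 := by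
            rw [Finset.sum_ite_mem]
        _ ≤ _ := Finset.sum_le_sum_of_subset_of_nonneg Finset.inter_subset_right
            fun _ _ _ => sq_nonneg _
    refine this.trans ?_
    rw [Finset.sum_const, Int.card_Icc, nsmul_eq_mul]
    have e : (((N : ℤ) + 1 - -(N : ℤ)).toNat : ℝ) = 2 * N + 1 := by
      have : ((N : ℤ) + 1 - -(N : ℤ)).toNat = 2 * N + 1 := by omega
      rw [this]; push_cast; ring
    rw [e, mul_pow]
    -- The factor `√(2N + 1)` would be enough; the larger one avoids a root and is harmless, as `δ`
    -- is chosen after `N`.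
    have : (1 : ℝ) ≤ 2 * N + 1 := by linarith
    exact mul_le_mul_of_nonneg_right (by nlinarith) (sq_nonneg _)
  have h2 := hq.const_mul (c := 1 / (N : ℝ)) (by positivity)
  refine ((h1.add h2).mono (fun _ => norm_nonneg _) fun k => ?_).le_of_le (le_of_eq (by ring))
  by_cases hk : |k| ≤ (N : ℤ)
  · rw [if_pos hk]
    have : 0 ≤ 1 / (N : ℝ) * (|(k : ℝ)| * ‖w k‖) := by positivity
    linarith [hlow k hk]
  · rw [if_neg hk, zero_add]
    have hk' : (N : ℝ) ≤ |(k : ℝ)| := by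
      have : (N : ℤ) ≤ |k| := (not_le.1 hk).le
      exact_mod_cast this
    rw [one_div, ← div_eq_inv_mul, le_div_iff₀ hN', mul_comm]
    exact mul_le_mul_of_nonneg_right hk' (norm_nonneg _)

/-- Finitely many modes determine the long-time behaviour in `H¹`. -/
theorem exists_determining_modes {γ : ℝ} (hγ : 0 < γ) {f : ℤ → ℂ} {Φ : ℝ} (hf : Force f Φ) :
    ∃ N : ℕ, 0 < N ∧ ∀ a b, Orbit γ f a → Orbit γ f b →
      (∀ k : ℤ, |k| ≤ N → Tendsto (fun t => ‖a t k - b t k‖) atTop (𝓝 0)) →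
      Tendsto (fun t => Real.sqrt (∑' k : ℤ, (|(k : ℝ)| * ‖a t k - b t k‖) ^ 2)) atTop (𝓝 0) := by
  obtain ⟨R', hR'⟩ := exists_absorbing_ball hγ hf
  -- The absorbing radius comes without a sign, hence the maximum with zero.
  set R := max R' 0 with hRdef
  have hR0 : 0 ≤ R := le_max_right _ _
  have hΦ := hf.l2₁.1
  have hc := embConst_nonneg
  obtain ⟨C, hC0, hC1, hC2⟩ : ∃ C : ℝ, 0 ≤ C ∧ embConst * (4 * (2 * ((|γ| + 2 * (embConst * R)) * R)
      + (|γ| + embConst * R) * R) + 4 * (|γ| * R + Φ + 2 * (embConst * R * R))) ≤ C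
      ∧ 4 * embConst * R ≤ C := by
    refine ⟨max (embConst * (4 * (2 * ((|γ| + 2 * (embConst * R)) * R)
      + (|γ| + embConst * R) * R) + 4 * (|γ| * R + Φ + 2 * (embConst * R * R))))
      (4 * embConst * R), ?_, le_max_left _ _, le_max_right _ _⟩
    exact le_max_of_le_right (by positivity)
  -- With `θ = C / N`, the first summand gives `θ (1 + γ) ≤ γ`, so the damping absorbs both the
  -- remainder and `γ` times the correction. The second gives `θ ≤ 1/2`, so the corrected energy
  -- controls half of the `H¹` norm squared, up to `e`.
  obtain ⟨N, hN⟩ := exists_nat_gt (C * (1 + γ) / γ + 2 * C)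
  have hNpos : (0 : ℝ) < N := lt_of_le_of_lt (by positivity) hN
  have hN0 : 0 < N := by exact_mod_cast hNpos
  set θ := C / N with hθ
  have hθ0 : 0 ≤ θ := by positivity
  have hθ1 : θ ≤ 1 / 2 := by
    rw [hθ, div_le_iff₀ hNpos]
    have : 0 ≤ C * (1 + γ) / γ := by positivity
    linarith
  have hθ2 : θ * (1 + γ) ≤ γ := by
    rw [hθ, div_mul_eq_mul_div, div_le_iff₀ hNpos, mul_comm γ, ← div_le_iff₀ hγ]
    linarith
  refine ⟨N, hN0, fun a b ha hb hlow => ?_⟩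
  have hdif : ∀ t k, dif (a t) (b t) k = a t k - b t k := fun t k => by simp [dif, sub_eq_add_neg]
  have hq : ∀ δ : ℝ, 0 < δ → ∀ᶠ t in atTop, 0 < t ∧ ∃ q e : ℝ, 0 ≤ q ∧
      e = 2 * R * C * ((2 * N + 1) * δ) ∧
      q ^ 2 = ∑' k : ℤ, (|(k : ℝ)| ^ 1 * ‖dif (a t) (b t) k‖) ^ 2 ∧
      |(tri diffSym (dif (a t) (b t)) (dif (a t) (b t)) (avg (a t) (b t))).re| ≤ e + θ * q ^ 2 ∧
      (tri diffSym (dif (kdvRem γ f (a t)) (kdvRem γ f (b t))) (dif (a t) (b t))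
            (avg (a t) (b t))
          + tri diffSym (dif (a t) (b t)) (dif (kdvRem γ f (a t)) (kdvRem γ f (b t)))
            (avg (a t) (b t))
          + tri diffSym (dif (a t) (b t)) (dif (a t) (b t))
            (avg (kdvRem γ f (a t)) (kdvRem γ f (b t)))).re ≤ e + θ * q ^ 2 := by
    intro δ hδ
    have hlow' : ∀ᶠ t in atTop, ∀ k ∈ Finset.Icc (-(N : ℤ)) N, ‖a t k - b t k‖ < δ := by
      rw [eventually_all_finset]
      intro k hk
      exact (hlow k (abs_le.2 (Finset.mem_Icc.1 hk))).eventually (gt_mem_nhds hδ)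
    filter_upwards [hlow', hR' a ha, hR' b hb, eventually_gt_atTop 0] with t h1 h2 h3 ht
    have h2' := h2.le_of_le (le_max_left R' 0)
    have h3' := h3.le_of_le (le_max_left R' 0)
    have hd : L2Le (fun k : ℤ => |(k : ℝ)| * ‖dif (a t) (b t) k‖) (R + R) :=
      (h2'.add h3').mono (fun _ => by positivity) fun k => by
        rw [← mul_add]
        exact mul_le_mul_of_nonneg_left (norm_dif_le _ _ k) (abs_nonneg _)
    have hdq := L2Le.of_summable hd.summable
    have hqR := hd.sqrt_tsum_le
    have hsq : Real.sqrt (∑' k : ℤ, (|(k : ℝ)| * ‖dif (a t) (b t) k‖) ^ 2) ^ 2 = _ :=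
      Real.sq_sqrt (tsum_nonneg fun k => sq_nonneg _)
    set q := Real.sqrt (∑' k : ℤ, (|(k : ℝ)| * ‖dif (a t) (b t) k‖) ^ 2) with hqdef
    have hq0 : 0 ≤ q := Real.sqrt_nonneg _
    have hp := l2Le_of_low_modes hN0 hδ.le (fun k hk => by
      rw [hdif]; exact (h1 k (Finset.mem_Icc.2 (abs_le.1 hk))).le) hdq
    have pb : PairBound γ Φ R f (a t) (b t) ((2 * N + 1) * δ + q / N) q :=
      ⟨hf, ha.zero t ht, hb.zero t ht, h2', h3', hp, hdq⟩
    have hpq : C * (((2 * N + 1) * δ + q / N) * q)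
        ≤ 2 * R * C * ((2 * N + 1) * δ) + θ * q ^ 2 := by
      have h4 : C * ((2 * N + 1) * δ) * q ≤ C * ((2 * N + 1) * δ) * (R + R) :=
        mul_le_mul_of_nonneg_left hqR (by positivity)
      have h5 : C * (q / N * q) = θ * q ^ 2 := by rw [hθ]; ring
      linarith
    have hPQ : 0 ≤ ((2 * N + 1) * δ + q / N) * q := mul_nonneg hp.1 hq0
    refine ⟨ht, q, _, hq0, rfl, ?_, ?_, ?_⟩
    · simpa using hsq
    · refine (Complex.abs_re_le_norm _).trans (pb.triLE_energy.norm_le.trans (le_trans ?_ hpq))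
      refine le_trans (le_of_eq ?_) (mul_le_mul_of_nonneg_right hC2 hPQ)
      ring
    · exact (le_abs_self _).trans ((Complex.abs_re_le_norm _).trans (pb.rate_le.trans
        ((mul_le_mul_of_nonneg_right hC1 hPQ).trans hpq)))
  have hfinal : ∀ ε : ℝ, 0 < ε → ∀ᶠ t in atTop,
      ∑' k : ℤ, (|(k : ℝ)| * ‖dif (a t) (b t) k‖) ^ 2 ≤ ε := by
    intro ε hε
    set M := 2 * R * C * (2 * N + 1) with hM
    have hM0 : 0 ≤ M := by positivity
    -- The error `e` equals `M δ`. Grönwall leaves `(1 + γ) M δ / γ`, the correction adds `M δ`, and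
    -- the factor `2` comes from `θ ≤ 1/2`. The other `ε / 2` is twice the Grönwall slack `ε / 4`.
    obtain ⟨δ, hδ, hδε⟩ : ∃ δ : ℝ, 0 < δ ∧ 2 * ((1 + γ) * (M * δ) / γ + M * δ) ≤ ε / 2 := by
      set K := 2 * ((1 + γ) * M / γ + M) with hK
      have hK0 : 0 ≤ K := by positivity
      refine ⟨ε / 2 / (K + 1), by positivity, ?_⟩
      have : 2 * ((1 + γ) * (M * (ε / 2 / (K + 1))) / γ + M * (ε / 2 / (K + 1)))
          = K / (K + 1) * (ε / 2) := by
        rw [hK]; ring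
      rw [this]
      refine mul_le_of_le_one_left (by positivity) ?_
      rw [div_le_one (by positivity)]
      linarith
    obtain ⟨t₀, ht₀⟩ := eventually_atTop.1 (hq δ hδ)
    have hMδ : 0 ≤ M * δ := by positivity
    have hev := (ha.hasRate_difference hf hb).eventually_le (c := γ) (C := (1 + γ) * (M * δ))
      (t₀ := max t₀ 1) hγ (by positivity) ?_ (ε := ε / 4) (by positivity)
    · filter_upwards [hev, hq δ hδ] with t h1 ⟨_, q, e, hq0, he, hqe, h2, h3⟩
      rw [← hqe] at h1
      have he' : e = M * δ := by rw [he, hM]; ring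
      have h4 := (abs_le.1 h2).1
      simp only [pow_one] at hqe
      rw [← hqe]
      have h5 : θ * q ^ 2 ≤ 1 / 2 * q ^ 2 := mul_le_mul_of_nonneg_right hθ1 (sq_nonneg q)
      linarith
    · intro t ht
      obtain ⟨_, q, e, hq0, he, hqe, h2, h3⟩ := ht₀ t ((le_max_left _ _).trans ht)
      rw [← hqe]
      have he' : e = M * δ := by rw [he, hM]; ring
      rw [he'] at h2 h3
      have h4 := mul_le_mul_of_nonneg_left (abs_le.1 h2).2 hγ.le
      have h5 := mul_le_mul_of_nonneg_right hθ2 (sq_nonneg q)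
      nlinarith
  have htend : Tendsto (fun t => ∑' k : ℤ, (|(k : ℝ)| * ‖dif (a t) (b t) k‖) ^ 2) atTop (𝓝 0) := by
    rw [Metric.tendsto_nhds]
    intro ε hε
    filter_upwards [hfinal (ε / 2) (by positivity)] with t ht
    rw [Real.dist_eq, sub_zero, abs_of_nonneg (tsum_nonneg fun _ => sq_nonneg _)]
    linarith
  have := htend.sqrt
  simpa only [hdif, Real.sqrt_zero] using this

open AddCircle (haarAddCircle)

/-! ### Fourier coefficients of square integrable functions -/

/-- The volume is `2π` times the normalised Haar measure and `2π ≥ 1`. Integrability therefore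
passes to the measure defining Fourier coefficients, and norm bounds need no constant. -/
theorem haarAddCircle_le_volume : (haarAddCircle : Measure T) ≤ volume := by
  rw [AddCircle.volume_eq_smul_haarAddCircle]
  refine Measure.le_iff.2 fun s _ => ?_
  rw [Measure.smul_apply, smul_eq_mul]
  refine le_mul_of_one_le_left zero_le ?_
  rw [ENNReal.one_le_ofReal]
  linarith [Real.pi_gt_three]

theorem memLp_complex (g : L2) : MemLp (fun x : T => ((g x : ℝ) : ℂ)) 2 haarAddCircle :=
  ((Lp.memLp g).ofReal (K := ℂ)).mono_measure haarAddCircle_le_volume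

theorem integrable_complex (g : L2) : Integrable (fun x : T => ((g x : ℝ) : ℂ)) haarAddCircle :=
  (memLp_complex g).integrable (by norm_num)

theorem ae_haar {p : T → Prop} (h : ∀ᵐ x : T, p x) : ∀ᵐ x ∂(haarAddCircle : Measure T), p x :=
  ae_mono haarAddCircle_le_volume h

theorem coeff_sub (g h : L2) (k : ℤ) : coeff (g - h) k = coeff g k - coeff h k := by
  simp only [coeff, fourierCoeff]
  rw [← integral_sub ((integrable_complex g).fourier_smul _)
    ((integrable_complex h).fourier_smul _)]
  refine integral_congr_ae ?_
  filter_upwards [ae_haar (Lp.coeFn_sub g h)] with x hx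
  rw [hx]
  simp [mul_sub]

theorem fourierCoeff_herm (g : T → ℝ) : Herm fun k => fourierCoeff (fun x : T => ((g x : ℝ) : ℂ)) k := by
  intro k
  simp only [fourierCoeff]
  rw [← integral_conj]
  refine integral_congr_ae (Eventually.of_forall fun x => ?_)
  simp only [smul_eq_mul, map_mul, Complex.conj_ofReal, ← fourier_neg]

theorem coeff_herm (g : L2) : Herm (coeff g) := fourierCoeff_herm _

theorem MemH.coeff_zero {m : ℕ} {g : L2} (h : MemH m g) : coeff g 0 = 0 := by
  simp only [coeff, fourierCoeff, AddCircle.integral_haarAddCircle]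
  have : ∀ x : T, fourier (-0) x • ((g x : ℝ) : ℂ) = ((g x : ℝ) : ℂ) := fun x => by
    rw [neg_zero, fourier_zero, one_smul]
  simp only [this]
  rw [integral_complex_ofReal, h.mean_free]
  simp

theorem coeff_eq_repr (g : L2) (k : ℤ) :
    coeff g k = fourierBasis.repr ((memLp_complex g).toLp _) k := by
  rw [fourierBasis_repr]
  exact (congrFun (fourierCoeff_congr_ae (memLp_complex g).coeFn_toLp) k).symm

theorem norm_coeff_le (g : L2) (k : ℤ) : ‖coeff g k‖ ≤ ‖g‖ := by
  rw [coeff_eq_repr, HilbertBasis.repr_apply_apply]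
  refine (norm_inner_le_norm _ _).trans ?_
  rw [fourierBasis.orthonormal.1 k, one_mul, Lp.norm_toLp, Lp.norm_def]
  refine ENNReal.toReal_mono (Lp.eLpNorm_ne_top g) ?_
  refine (eLpNorm_mono_measure _ haarAddCircle_le_volume).trans (le_of_eq ?_)
  exact eLpNorm_congr_norm_ae (Eventually.of_forall fun x => by simp)

/-- Parseval's identity for the pair `e_k g` and `g`, whose inner product is the `k`-th coefficient
of `g²` because `g` is real. -/
theorem fourierCoeff_sq (g : L2) (k : ℤ) :
    fourierCoeff (fun x : T => (((g x) ^ 2 : ℝ) : ℂ)) k = conv (coeff g) (coeff g) k := by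
  have hm : MemLp (fun x : T => fourier k x * ((g x : ℝ) : ℂ)) 2 haarAddCircle := by
    refine (memLp_complex g).of_le
      ((map_continuous (fourier k)).aestronglyMeasurable.mul (memLp_complex g).1)
      (Eventually.of_forall fun x => ?_)
    rw [norm_mul, fourier_apply, Circle.norm_coe, one_mul]
  set y := (memLp_complex g).toLp _ with hy
  set x := hm.toLp _ with hx
  have h1 := fourierBasis.tsum_inner_mul_inner x y
  have e1 : ∀ i, inner ℂ (fourierBasis i) y = coeff g i := fun i => by
    rw [coeff_eq_repr, HilbertBasis.repr_apply_apply]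
  have e2 : ∀ i, inner ℂ x (fourierBasis i) = coeff g (k - i) := fun i => by
    rw [MeasureTheory.L2.inner_def, coe_fourierBasis, coeff, fourierCoeff]
    refine integral_congr_ae ?_
    filter_upwards [hm.coeFn_toLp, coeFn_fourierLp 2 i] with z h2 h3
    rw [RCLike.inner_apply', hx, h2, h3, map_mul, ← fourier_neg, Complex.conj_ofReal, smul_eq_mul,
      show -(k - i) = -k + i by ring, fourier_add]
    ring
  have e3 : inner ℂ x y = fourierCoeff (fun x : T => (((g x) ^ 2 : ℝ) : ℂ)) k := by
    rw [MeasureTheory.L2.inner_def, fourierCoeff]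
    refine integral_congr_ae ?_
    filter_upwards [hm.coeFn_toLp, (memLp_complex g).coeFn_toLp] with z h2 h3
    rw [RCLike.inner_apply', hx, hy, h2, h3, map_mul, ← fourier_neg, Complex.conj_ofReal,
      smul_eq_mul]
    push_cast
    ring
  rw [← e3, ← h1, conv]
  refine tsum_congr fun j => ?_
  rw [e1, e2, mul_comm]

theorem coeff_proj (N : ℕ) (g : L2) {k : ℤ} (hk : |k| ≤ N) : coeff (proj N g) k = coeff g k := by
  have hreal : ∀ x : T, ((truncation N g x : ℝ) : ℂ)
      = ∑ j ∈ Finset.Icc (-(N : ℤ)) N, coeff g j * fourier j x := by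
    intro x
    refine Complex.conj_eq_iff_re.1 ?_
    rw [map_sum]
    refine Finset.sum_equiv (Equiv.neg ℤ) (fun j => ?_) fun j _ => ?_
    · simp only [Finset.mem_Icc, Equiv.neg_apply]
      constructor <;> rintro ⟨h1, h2⟩ <;> constructor <;> linarith
    · rw [map_mul, Equiv.neg_apply, coeff_herm g j, fourier_neg]
  have h1 : coeff (proj N g) k
      = fourierCoeff (∑ j ∈ Finset.Icc (-(N : ℤ)) N, fun x : T => coeff g j * fourier j x) k := by
    rw [coeff, fourierCoeff_congr_ae]
    filter_upwards [ae_haar (ContinuousMap.coeFn_toLp (p := 2) (𝕜 := ℝ) volume (truncation N g))]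
      with x hx
    rw [proj, hx, hreal, Finset.sum_apply]
  rw [h1, fourierCoeff.sum]
  · rw [Finset.sum_apply, Finset.sum_eq_single k]
    · rw [fourierCoeff.const_mul, fourierCoeff_fourier]
      simp
    · intro j _ hj
      rw [fourierCoeff.const_mul, fourierCoeff_fourier]
      simp [hj.symm]
    · intro h
      exact absurd (Finset.mem_Icc.2 (abs_le.1 hk)) h
  · intro j _
    exact (continuous_const.mul (map_continuous (fourier j))).integrable_of_hasCompactSupport
      (HasCompactSupport.of_compactSpace _)

/-! ### Trigonometric moments -/

theorem fourier_neg_coe (k : ℤ) (x : ℝ) :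
    fourier (-k) (x : T) = (Real.cos (k * x) : ℂ) - Real.sin (k * x) * I := by
  rw [fourier_coe_apply]
  have hpi : (Real.pi : ℂ) ≠ 0 := by exact_mod_cast Real.pi_ne_zero
  have : 2 * (Real.pi : ℂ) * I * ((-k : ℤ) : ℂ) * x / ((2 * Real.pi : ℝ) : ℂ)
      = ((-(k * x) : ℝ) : ℂ) * I := by
    push_cast
    field_simp
  rw [this, Complex.exp_mul_I, ← Complex.ofReal_cos, ← Complex.ofReal_sin, Real.cos_neg,
    Real.sin_neg]
  push_cast
  ring

theorem intervalIntegrable_lift {g : T → ℝ} (hg : Integrable g) :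
    IntervalIntegrable (fun x : ℝ => g (x : T)) volume 0 (2 * Real.pi) := by
  have h := (AddCircle.measurePreserving_mk (2 * Real.pi) 0).integrable_comp_of_integrable hg
  rw [intervalIntegrable_iff_integrableOn_Ioc_of_le Real.two_pi_pos.le]
  simpa [IntegrableOn, Function.comp_def] using h

theorem trig_moments {g : T → ℝ} (hg : Integrable g) (k : ℤ) :
    (∫ x in (0 : ℝ)..(2 * Real.pi), g (x : T) * Real.cos (k * x)
      = 2 * Real.pi * (fourierCoeff (fun x : T => ((g x : ℝ) : ℂ)) k).re) ∧
    (∫ x in (0 : ℝ)..(2 * Real.pi), g (x : T) * Real.sin (k * x)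
      = -(2 * Real.pi * (fourierCoeff (fun x : T => ((g x : ℝ) : ℂ)) k).im)) := by
  have hi := intervalIntegrable_lift hg
  have hc : IntervalIntegrable (fun x : ℝ => g (x : T) * Real.cos (k * x)) volume 0
      (2 * Real.pi) := hi.mul_continuousOn (by fun_prop)
  have hs : IntervalIntegrable (fun x : ℝ => g (x : T) * Real.sin (k * x)) volume 0
      (2 * Real.pi) := hi.mul_continuousOn (by fun_prop)
  have hcC : IntervalIntegrable (fun x : ℝ => ((g (x : T) * Real.cos (k * x) : ℝ) : ℂ)) volume 0
      (2 * Real.pi) := ⟨hc.1.ofReal, hc.2.ofReal⟩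
  have hsC : IntervalIntegrable (fun x : ℝ => ((g (x : T) * Real.sin (k * x) : ℝ) : ℂ)) volume 0
      (2 * Real.pi) := ⟨hs.1.ofReal, hs.2.ofReal⟩
  have key : fourierCoeff (fun x : T => ((g x : ℝ) : ℂ)) k = (1 / (2 * Real.pi) : ℝ) *
      (((∫ x in (0 : ℝ)..(2 * Real.pi), g (x : T) * Real.cos (k * x) : ℝ) : ℂ)
        - ((∫ x in (0 : ℝ)..(2 * Real.pi), g (x : T) * Real.sin (k * x) : ℝ) : ℂ) * I) := by
    rw [fourierCoeff_eq_intervalIntegral _ _ 0, zero_add, ← intervalIntegral.integral_ofReal,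
      ← intervalIntegral.integral_ofReal, ← intervalIntegral.integral_mul_const,
      ← intervalIntegral.integral_sub hcC (hsC.mul_const I), Complex.real_smul]
    congr 1
    refine intervalIntegral.integral_congr fun x _ => ?_
    simp only [fourier_neg_coe, smul_eq_mul]
    push_cast
    ring
  have hpi := Real.pi_pos
  rw [key, Complex.re_ofReal_mul, Complex.im_ofReal_mul]
  simp only [Complex.sub_re, Complex.sub_im, Complex.ofReal_re, Complex.ofReal_im,
    Complex.re_ofReal_mul, Complex.im_ofReal_mul, Complex.I_re, Complex.I_im]
  constructor <;> field_simp <;> ring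

theorem fourierCoeff_lincomb {g h : T → ℝ} (hg : Integrable g) (hh : Integrable h) (α β : ℝ)
    (k : ℤ) : fourierCoeff (fun x : T => ((α * g x + β * h x : ℝ) : ℂ)) k
      = α * fourierCoeff (fun x : T => ((g x : ℝ) : ℂ)) k
        + β * fourierCoeff (fun x : T => ((h x : ℝ) : ℂ)) k := by
  have hg' : Integrable (fun x : T => ((g x : ℝ) : ℂ)) haarAddCircle :=
    hg.ofReal.mono_measure haarAddCircle_le_volume
  have hh' : Integrable (fun x : T => ((h x : ℝ) : ℂ)) haarAddCircle :=
    hh.ofReal.mono_measure haarAddCircle_le_volume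
  simp only [fourierCoeff]
  rw [← integral_const_mul, ← integral_const_mul,
    ← integral_add ((hg'.fourier_smul _).const_mul _) ((hh'.fourier_smul _).const_mul _)]
  refine integral_congr_ae (Eventually.of_forall fun x => ?_)
  simp only [smul_eq_mul]
  push_cast
  ring

theorem deriv_cos_mul (k : ℝ) :
    deriv (fun x : ℝ => Real.cos (k * x)) = fun x => -k * Real.sin (k * x) := by
  funext x
  have := ((hasDerivAt_id x).const_mul k).cos
  simpa [mul_comm] using this.deriv

theorem deriv_sin_mul (k : ℝ) :
    deriv (fun x : ℝ => Real.sin (k * x)) = fun x => k * Real.cos (k * x) := by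
  funext x
  have := ((hasDerivAt_id x).const_mul k).sin
  simpa [mul_comm] using this.deriv

theorem iteratedDeriv_three_cos_mul (k : ℝ) :
    iteratedDeriv 3 (fun x : ℝ => Real.cos (k * x)) = fun x => k ^ 3 * Real.sin (k * x) := by
  rw [iteratedDeriv_succ, iteratedDeriv_succ, iteratedDeriv_one, deriv_cos_mul,
    deriv_const_mul_field', deriv_sin_mul]
  funext x
  simp only [deriv_const_mul_field', deriv_cos_mul]
  ring

theorem iteratedDeriv_three_sin_mul (k : ℝ) :
    iteratedDeriv 3 (fun x : ℝ => Real.sin (k * x)) = fun x => -k ^ 3 * Real.cos (k * x) := by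
  rw [iteratedDeriv_succ, iteratedDeriv_succ, iteratedDeriv_one, deriv_sin_mul,
    deriv_const_mul_field', deriv_cos_mul]
  funext x
  simp only [deriv_const_mul_field', deriv_sin_mul]
  ring

/-- The `k`-th Fourier coefficient of the Korteweg--de Vries vector field. -/
noncomputable def kdvField (γ : ℝ) (f a : ℤ → ℂ) (k : ℤ) : ℂ :=
  I * (k : ℂ) ^ 3 * a k + kdvRem γ f a k

/-- Derivatives of odd order on the test function exchange cosine and sine, which is multiplication
by `i` on coefficients. Hence `A` gathers the terms with odd derivatives and `B` the others, and the
field is the coefficient of `B` plus `i` times that of `A`. -/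
theorem weakRHS_trig (γ : ℝ) (f v : L2) (k : ℤ) :
    weakRHS γ f v (fun x => Real.cos (k * x))
      = 2 * Real.pi * (kdvField γ (coeff f) (coeff v) k).re ∧
    weakRHS γ f v (fun x => Real.sin (k * x))
      = -(2 * Real.pi * (kdvField γ (coeff f) (coeff v) k).im) := by
  have hv : Integrable (fun x : T => v x) := (Lp.memLp v).integrable (by norm_num)
  have hf : Integrable (fun x : T => f x) := (Lp.memLp f).integrable (by norm_num)
  have hv2 : Integrable (fun x : T => v x ^ 2) := (Lp.memLp v).integrable_sq
  set A : T → ℝ := fun x => (-(k : ℝ) / 2) * v x ^ 2 + (k : ℝ) ^ 3 * v x with hA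
  set B : T → ℝ := fun x => -γ * v x + 1 * f x with hB
  have hAi : Integrable A := (hv2.const_mul _).add (hv.const_mul _)
  have hBi : Integrable B := (hv.const_mul _).add (hf.const_mul _)
  have eA := fourierCoeff_lincomb hv2 hv (-(k : ℝ) / 2) ((k : ℝ) ^ 3) k
  have eB := fourierCoeff_lincomb hv hf (-γ) 1 k
  have hfield : kdvField γ (coeff f) (coeff v) k
      = fourierCoeff (fun x : T => ((B x : ℝ) : ℂ)) k
        + I * fourierCoeff (fun x : T => ((A x : ℝ) : ℂ)) k := by
    rw [eA, eB, fourierCoeff_sq]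
    simp only [kdvField, kdvRem, coeff]
    push_cast
    ring
  have iA := intervalIntegrable_lift hAi
  have iB := intervalIntegrable_lift hBi
  have tA := trig_moments hAi k
  have tB := trig_moments hBi k
  rw [hfield]
  simp only [Complex.add_re, Complex.add_im, Complex.mul_re, Complex.mul_im, Complex.I_re,
    Complex.I_im, zero_mul, one_mul, zero_sub, zero_add]
  constructor
  · rw [weakRHS, deriv_cos_mul, iteratedDeriv_three_cos_mul]
    have : ∀ x : ℝ, (1 / 2) * (v (x : T)) ^ 2 * (-(k : ℝ) * Real.sin (k * x))
        + v (x : T) * ((k : ℝ) ^ 3 * Real.sin (k * x)) - γ * v (x : T) * Real.cos (k * x)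
        + f (x : T) * Real.cos (k * x) = A x * Real.sin (k * x) + B x * Real.cos (k * x) :=
      fun x => by simp only [hA, hB]; ring
    simp only [this]
    rw [intervalIntegral.integral_add (iA.mul_continuousOn (by fun_prop))
      (iB.mul_continuousOn (by fun_prop)), tA.2, tB.1]
    ring
  · rw [weakRHS, deriv_sin_mul, iteratedDeriv_three_sin_mul]
    have : ∀ x : ℝ, (1 / 2) * (v (x : T)) ^ 2 * ((k : ℝ) * Real.cos (k * x))
        + v (x : T) * (-(k : ℝ) ^ 3 * Real.cos (k * x)) - γ * v (x : T) * Real.sin (k * x)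
        + f (x : T) * Real.sin (k * x) = B x * Real.sin (k * x) - A x * Real.cos (k * x) :=
      fun x => by simp only [hA, hB]; ring
    simp only [this]
    rw [intervalIntegral.integral_sub (iB.mul_continuousOn (by fun_prop))
      (iA.mul_continuousOn (by fun_prop)), tA.1, tB.2]
    ring

/-! ### From weak solutions to Fourier orbits -/

theorem MemH.l2Le {g : L2} (h : MemH 2 g) :
    L2Le (fun k : ℤ => |(k : ℝ)| * (|(k : ℝ)| * ‖coeff g k‖)) (normH 2 g) := by
  have e : ∀ k : ℤ, (|k| : ℝ) ^ (2 * 2) * ‖coeff g k‖ ^ 2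
      = (|(k : ℝ)| * (|(k : ℝ)| * ‖coeff g k‖)) ^ 2 := fun k => by ring
  have h1 := h.summable
  simp only [e] at h1
  simpa only [normH, e] using L2Le.of_summable h1

theorem MemH.of_sub_l2Le {g h : L2} (hg : MemH 2 g) (hh : MemH 2 h) :
    L2Le (fun k : ℤ => |(k : ℝ)| * (|(k : ℝ)| * ‖coeff (g - h) k‖)) (normH 2 (g - h)) := by
  -- Summability comes first: for a divergent sum the `tsum` in `normH` would default to zero and
  -- bound nothing.
  have h1 : L2Le (fun k : ℤ => |(k : ℝ)| * (|(k : ℝ)| * ‖coeff (g - h) k‖))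
      (normH 2 g + normH 2 h) := by
    refine (hg.l2Le.add hh.l2Le).mono (fun _ => by positivity) fun k => ?_
    rw [coeff_sub, ← mul_add, ← mul_add]
    gcongr
    exact norm_sub_le _ _
  have e : ∀ k : ℤ, (|k| : ℝ) ^ (2 * 2) * ‖coeff (g - h) k‖ ^ 2
      = (|(k : ℝ)| * (|(k : ℝ)| * ‖coeff (g - h) k‖)) ^ 2 := fun k => by ring
  simpa only [normH, e] using L2Le.of_summable h1.summable

theorem normH_le_add {g h : L2} (hg : MemH 2 g) (hh : MemH 2 h) :
    normH 2 g ≤ normH 2 (g - h) + normH 2 h := by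
  have h1 : L2Le (fun k : ℤ => |(k : ℝ)| * (|(k : ℝ)| * ‖coeff g k‖))
      (normH 2 (g - h) + normH 2 h) := by
    refine ((hg.of_sub_l2Le hh).add hh.l2Le).mono (fun _ => by positivity) fun k => ?_
    rw [coeff_sub, ← mul_add, ← mul_add]
    gcongr
    simpa using norm_add_le (coeff g k - coeff h k) (coeff h k)
  have e : ∀ k : ℤ, (|k| : ℝ) ^ (2 * 2) * ‖coeff g k‖ ^ 2
      = (|(k : ℝ)| * (|(k : ℝ)| * ‖coeff g k‖)) ^ 2 := fun k => by ring
  simpa only [normH, e] using h1.sqrt_tsum_le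

theorem normH_sub_comm (m : ℕ) (g h : L2) : normH m (g - h) = normH m (h - g) := by
  simp only [normH, coeff_sub, norm_sub_rev]

theorem MemH.force {f : L2} (h : MemH 2 f) :
    Force (coeff f) (normH 2 f + embConst * normH 2 f) :=
  ⟨h.coeff_zero, coeff_herm f, (H2Bound.of_weighted h.coeff_zero h.l2Le).l2₁⟩

namespace ContinuousInH

variable {u : ℝ → L2}

theorem continuousOn_normH (h : ContinuousInH 2 u) :
    ContinuousOn (fun t => normH 2 (u t)) (Set.Ici 0) := by
  intro s hs
  refine tendsto_iff_norm_sub_tendsto_zero.2 ?_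
  refine squeeze_zero' (Eventually.of_forall fun _ => norm_nonneg _) ?_ (h.tendsto s hs)
  filter_upwards [self_mem_nhdsWithin] with t ht
  have h1 := normH_le_add (h.memH t ht) (h.memH s hs)
  have h2 := normH_le_add (h.memH s hs) (h.memH t ht)
  rw [normH_sub_comm] at h2
  rw [Real.norm_eq_abs, abs_le]
  constructor <;> linarith

theorem exists_bound (h : ContinuousInH 2 u) (S : ℝ) : ∃ B, ∀ t, 0 ≤ t → t ≤ S →
    L2Le (fun k : ℤ => |(k : ℝ)| * (|(k : ℝ)| * ‖coeff (u t) k‖)) B := by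
  obtain ⟨B, hB⟩ := (isCompact_Icc (a := (0 : ℝ)) (b := S)).exists_bound_of_continuousOn
    (h.continuousOn_normH.mono fun x hx => hx.1)
  exact ⟨B, fun t ht hS => (h.memH t ht).l2Le.le_of_le
    ((le_abs_self _).trans (hB t ⟨ht, hS⟩))⟩

theorem continuousOn_coeff (h : ContinuousInH 2 u) (k : ℤ) :
    ContinuousOn (fun t => coeff (u t) k) (Set.Ici 0) := by
  intro s hs
  refine tendsto_iff_norm_sub_tendsto_zero.2 ?_
  refine squeeze_zero' (Eventually.of_forall fun _ => norm_nonneg _) ?_ (h.tendsto s hs)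
  filter_upwards [self_mem_nhdsWithin] with t ht
  have h1 := (h.memH t ht).of_sub_l2Le (h.memH s hs)
  rw [← coeff_sub]
  by_cases hk : k = 0
  · rw [hk, coeff_sub, (h.memH t ht).coeff_zero, (h.memH s hs).coeff_zero]
    simpa using h1.1
  · have hk' := one_le_abs_intCast hk
    refine le_trans ?_ (h1.le_apply k)
    refine (le_mul_of_one_le_left (norm_nonneg _) hk').trans ?_
    exact le_mul_of_one_le_left (by positivity) hk'

theorem continuousOn_kdvField (h : ContinuousInH 2 u) (γ : ℝ) (f : ℤ → ℂ) (k : ℤ) (S : ℝ) :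
    ContinuousOn (fun t => kdvField γ f (coeff (u t)) k) (Set.Icc 0 S) := by
  obtain ⟨B, hB⟩ := h.exists_bound S
  have hc : ∀ k, ContinuousOn (fun t => coeff (u t) k) (Set.Icc 0 S) := fun k =>
    (h.continuousOn_coeff k).mono fun x hx => hx.1
  have hconv := continuousOn_conv_self hc (fun t ht => (h.memH t ht.1).coeff_zero)
    (fun t ht => hB t ht.1 ht.2) k
  unfold kdvField kdvRem
  exact (continuousOn_const.mul (hc k)).add
    (((continuousOn_const.mul (hc k)).add continuousOn_const).sub (continuousOn_const.mul hconv))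

end ContinuousInH

theorem hasDerivAt_of_integral_eq {g h : ℝ → ℝ} (hc : ∀ S, ContinuousOn h (Set.Icc 0 S))
    (hg : ∀ t, 0 ≤ t → g t = g 0 + ∫ s in (0 : ℝ)..t, h s) {t : ℝ} (ht : 0 < t) :
    HasDerivAt g (h t) t := by
  have hcont : ContinuousOn h (Set.Ioo 0 (t + 1)) :=
    (hc (t + 1)).mono Set.Ioo_subset_Icc_self
  have hmem : Set.Ioo 0 (t + 1) ∈ 𝓝 t := Ioo_mem_nhds ht (lt_add_one t)
  have hint : IntervalIntegrable h volume 0 t :=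
    ((hc t).mono (by rw [Set.uIcc_of_le ht.le])).intervalIntegrable
  have h1 := intervalIntegral.integral_hasDerivAt_right hint
    (hcont.stronglyMeasurableAtFilter isOpen_Ioo t ⟨ht, lt_add_one t⟩) (hcont.continuousAt hmem)
  refine (h1.const_add (g 0)).congr_of_eventuallyEq ?_
  filter_upwards [hmem] with τ hτ
  exact hg τ hτ.1.le

/-- Testing with `cos kx` and `sin kx` gives the real and imaginary parts of an integral equation
for each mode. Its integrand is continuous in time, so each mode solves its equation classically for
`t > 0`. -/
theorem IsSolution.orbit {γ : ℝ} {f u₀ : L2} {u : ℝ → L2} (h : IsSolution γ f u₀ u) :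
    Orbit γ (coeff f) (fun t => coeff (u t)) where
  zero t ht := (h.continuous.memH t ht.le).coeff_zero
  herm t _ := coeff_herm (u t)
  bdd S := by
    obtain ⟨B, hB⟩ := h.continuous.exists_bound S
    exact ⟨B, fun t ht hS => hB t ht.le hS⟩
  deriv k t ht := by
    have hi : ∀ g : L2, Integrable (fun x : T => g x) := fun g =>
      (Lp.memLp g).integrable (by norm_num)
    have hpi : (2 * Real.pi) ≠ 0 := Real.two_pi_pos.ne'
    have hper : ∀ x : ℝ, (k : ℝ) * (x + 2 * Real.pi) = k * x + k * (2 * Real.pi) := fun x => by ring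
    have hV := fun S => h.continuous.continuousOn_kdvField γ (coeff f) k S
    have hre : HasDerivAt (fun t => (coeff (u t) k).re)
        (kdvField γ (coeff f) (coeff (u t)) k).re t := by
      refine hasDerivAt_of_integral_eq (h := fun t => (kdvField γ (coeff f) (coeff (u t)) k).re)
        (fun S => Complex.continuous_re.comp_continuousOn (hV S)) (fun t ht => ?_) ht
      have hw := h.weak (fun x => Real.cos (k * x)) (by fun_prop)
        (fun x => by simp only [hper, Real.cos_add_int_mul_two_pi]) t ht
      simp only [(weakRHS_trig γ f _ k).1, (trig_moments (hi _) k).1] at hw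
      rw [intervalIntegral.integral_const_mul, ← mul_add, ← h.initial] at hw
      exact mul_left_cancel₀ hpi hw
    have him : HasDerivAt (fun t => (coeff (u t) k).im)
        (kdvField γ (coeff f) (coeff (u t)) k).im t := by
      refine hasDerivAt_of_integral_eq (h := fun t => (kdvField γ (coeff f) (coeff (u t)) k).im)
        (fun S => Complex.continuous_im.comp_continuousOn (hV S)) (fun t ht => ?_) ht
      have hw := h.weak (fun x => Real.sin (k * x)) (by fun_prop)
        (fun x => by simp only [hper, Real.sin_add_int_mul_two_pi]) t ht
      simp only [(weakRHS_trig γ f _ k).2, (trig_moments (hi _) k).2] at hw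
      rw [intervalIntegral.integral_neg, intervalIntegral.integral_const_mul, ← neg_add,
        neg_inj, ← mul_add, ← h.initial] at hw
      exact mul_left_cancel₀ hpi hw
    have := hre.ofReal_comp.add (him.ofReal_comp.mul_const I)
    rw [Complex.re_add_im] at this
    refine this.congr_of_eventuallyEq (Eventually.of_forall fun τ => ?_)
    exact (Complex.re_add_im _).symm

end DampedKdV

/-! ### The main theorem -/

theorem theorem8p2 (γ : ℝ) (hγ : 0 < γ) (f : DampedKdV.L2) (hf : DampedKdV.MemH 2 f) :
    ∃ N : ℕ, 0 < N ∧
      ∀ (u₀ v₀ : DampedKdV.L2) (u v : ℝ → DampedKdV.L2),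
        DampedKdV.MemH 2 u₀ → DampedKdV.MemH 2 v₀ →
        DampedKdV.IsSolution γ f u₀ u → DampedKdV.IsSolution γ f v₀ v →
        Tendsto (fun t => ‖DampedKdV.proj N (u t - v t)‖) atTop (𝓝 0) →
        Tendsto (fun t => DampedKdV.normH 1 (u t - v t)) atTop (𝓝 0) := by
  obtain ⟨N, hN, h⟩ := DampedKdV.exists_determining_modes hγ hf.force
  refine ⟨N, hN, fun u₀ v₀ u v _ _ hu hv hp => ?_⟩
  refine (h _ _ hu.orbit hv.orbit fun k hk => ?_).congr fun t => ?_
  -- Each coefficient with `|k| ≤ N` is a coefficient of the projection, hence bounded by its `L²`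
  -- norm.
  · refine squeeze_zero (fun _ => norm_nonneg _) (fun t => ?_) hp
    rw [← DampedKdV.coeff_sub, ← DampedKdV.coeff_proj N _ hk]
    exact DampedKdV.norm_coeff_le _ _
  · simp only [DampedKdV.normH, DampedKdV.coeff_sub, mul_pow, mul_one]
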